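/- Let $A$ be a finite non-empty set of actions. Action $a\in A$ has a sub-Gaussian reward distribution $F_a$ on $\mathbb{R}$ with mean $\mu_a$, i.e. for some $\sigma_a^2$, $\int e^{\lambda (x-\mu_a)}\,\mathrm{d}F_a(x)\le e^{\lambda^2\sigma_a^2/2}$ for all $\lambda\in\mathbb{R}$. Let $(\varepsilon_t)_{t\ge 1}$ be a $[0,1]$-valued sequence with $\varepsilon_t\to 0$ and $\sum_{t=1}^\infty\varepsilon_t=\infty$. $\varepsilon$-Greedy chooses actions $a_1,a_2,\dots$ and receives rewards $r_1,r_2,\dots$ as follows: in round $t$, given the past, with probability $1-\varepsilon_t$ the action $a_t$ is uniform on $\arg\max_{a\in A}\hat\mu_a(t-1)$, and with probability $\varepsilon_t$ it is uniform on $A$; then $r_t$ is drawn from $F_{a_t}$. Here $\hat\mu_a(t)=\frac{1}{N_a(t)}\sum_{t'\le t,\,a_{t'}=a} r_{t'}$ is the average observed reward of action $a$, where $N_a(t)=|\{1\le t'\le t: a_{t'}=a\}|$, and $\hat\mu_a(t)=0$ if $N_a(t)=0$. For distributions $F,F'$ on $\mathbb{R}$ write $F'\prec_{\mathrm{SOSD}}F$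 if $\int u\,\mathrm{d}F\ge\int u\,\mathrm{d}F'$ for all concave non-decreasing $u:\mathbb{R}\to\mathbb{R}$ with finite expectations under both $F$ and $F'$, with strict inequality for some such $u$. Call $a\in A$ dominant if for every $a'\in A\setminus\{a\}$, $\mu_{a'}<\mu_a$ or $F_{a'}\prec_{\mathrm{SOSD}}F_a$. Assume that there is a dominant action $a$ whose reward is deterministic and centered, i.e. $F_a$ is the point mass at $0$, and that for every other action $a'$ the distribution $F_{a'}$ is symmetric about some point and continuous, i.e. it has no atoms. Then $\varepsilon$-Greedy is perfectly risk-averse on this problem: the dominant action $a$ satisfies $$\lim_{t\to\infty}\mathbb{P}[a_t=a]=1.$$ -/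

import Mathlib

open MeasureTheory ProbabilityTheory Filter Topology

universe u v

namespace Bandit

/-- A reward distribution is sub-Gaussian if, for some variance proxy `c`, its deviation from the
mean satisfies `∫ exp (l * (x - mean)) ≤ exp (c * l ^ 2 / 2)` for all real `l`. -/
def IsSubGaussian (ν : Measure ℝ) : Prop :=
  ∃ c : NNReal, HasSubgaussianMGF (fun x : ℝ => x - ∫ y, y ∂ν) c ν

/-- The distribution is symmetric about some center `c`. -/
def IsSymmetric (ν : Measure ℝ) : Prop :=
  ∃ c : ℝ, ν.map (fun x => 2 * c - x) = ν

/-- The distribution is continuous: no single value has positive probability, that is, the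
cumulative distribution function is continuous. -/
def IsContinuousDist (ν : Measure ℝ) : Prop :=
  ∀ x : ℝ, ν {x} = 0

/-- Second-order stochastic dominance of `ν'` by `ν`: every concave non-decreasing `u` (with finite
expectations) has at least as large an expectation under `ν`, strictly larger for some such `u`. -/
def SOSD (ν' ν : Measure ℝ) : Prop :=
  (∀ u : ℝ → ℝ, ConcaveOn ℝ Set.univ u → Monotone u → Integrable u ν' → Integrable u ν →
    ∫ x, u x ∂ν' ≤ ∫ x, u x ∂ν) ∧
  ∃ u : ℝ → ℝ, ConcaveOn ℝ Set.univ u ∧ Monotone u ∧ Integrable u ν' ∧ Integrable u ν ∧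
    ∫ x, u x ∂ν' < ∫ x, u x ∂ν

/-- Action `a` is dominant: every other action has a strictly smaller mean reward or a reward
distribution that is second-order stochastically dominated by that of `a`. -/
def IsDominant {A : Type*} (F : A → Measure ℝ) (a : A) : Prop :=
  ∀ a', a' ≠ a → (∫ x, x ∂(F a') < ∫ x, x ∂(F a)) ∨ SOSD (F a') (F a)

/-- A strategy maps the history of the rounds `0, …, t - 1` (pairs of an action and its reward)
to a probability vector on the actions, used to draw the action of round `t`. -/
def Strategy (A : Type*) [Fintype A] : Type _ :=
  (t : ℕ) → (Fin t → A × ℝ) → stdSimplex ℝ A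

section Greedy

variable {A : Type*}

open Classical in
/-- The number of times that action `a` was chosen in the history `h`. -/
noncomputable def count {t : ℕ} (h : Fin t → A × ℝ) (a : A) : ℕ :=
  (Finset.univ.filter (fun i => (h i).1 = a)).card

open Classical in
/-- The average reward of action `a` in the history `h`; the estimate of an action that has not
been chosen yet is `0`. -/
noncomputable def avgReward {t : ℕ} (h : Fin t → A × ℝ) (a : A) : ℝ :=
  if count h a = 0 then 0
  else (∑ i ∈ Finset.univ.filter (fun i => (h i).1 = a), (h i).2) / (count h a : ℝ)

variable [Fintype A]

open Classical in
/-- The set of maximizers of `f`. -/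
noncomputable def argmax (f : A → ℝ) : Finset A :=
  Finset.univ.filter (fun a => ∀ b, f b ≤ f a)

theorem argmax_nonempty [Nonempty A] (f : A → ℝ) : (argmax f).Nonempty := by
  obtain ⟨a, ha⟩ := Finite.exists_max f
  exact ⟨a, by simpa [argmax] using ha⟩

open Classical in
/-- The mixture of the uniform distribution on the maximizers of `f`, with weight `1 - e`, and the
uniform distribution on all actions, with weight `e`. -/
noncomputable def greedyProb (e : ℝ) (f : A → ℝ) (a : A) : ℝ :=
  (1 - e) * (if a ∈ argmax f then 1 / ((argmax f).card : ℝ) else 0) + e * (1 / (Fintype.card A : ℝ))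

theorem greedyProb_mem [Nonempty A] (e : unitInterval) (f : A → ℝ) :
    greedyProb (e : ℝ) f ∈ stdSimplex ℝ A := by
  have h0 := e.2.1
  have h1 : 0 ≤ 1 - (e : ℝ) := sub_nonneg.2 e.2.2
  have hc : ((argmax f).card : ℝ) ≠ 0 := by
    exact_mod_cast (Finset.card_pos.2 (argmax_nonempty f)).ne'
  have hA : (Fintype.card A : ℝ) ≠ 0 := by exact_mod_cast Fintype.card_ne_zero
  refine ⟨fun a => ?_, ?_⟩
  · unfold greedyProb
    split_ifs <;> positivity
  · simp only [greedyProb, Finset.sum_add_distrib, ← Finset.mul_sum, Finset.sum_ite_mem,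
      Finset.univ_inter, Finset.sum_const, nsmul_eq_mul, Finset.card_univ]
    field_simp
    ring

/-- The `ε`-Greedy strategy with exploration rates `ε 0, ε 1, …`. -/
noncomputable def epsGreedy [Nonempty A] (ε : ℕ → unitInterval) : Strategy A :=
  fun t h => ⟨greedyProb (ε t : ℝ) (avgReward h), greedyProb_mem (ε t) (avgReward h)⟩

end Greedy

section Model

variable {A : Type*} {Ω : Type*}

/-- The random history of the rounds `0, …, t - 1`. -/
def hist (act : ℕ → Ω → A) (rew : ℕ → Ω → ℝ) (t : ℕ) (ω : Ω) : Fin t → A × ℝ :=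
  fun i => (act i ω, rew i ω)

variable [Fintype A] [MeasurableSpace A] [MeasurableSpace Ω]

/-- The actions `act t` and rewards `rew t` are generated by the strategy `π` in the bandit problem
with reward distributions `F`: given the history before round `t`, the action of round `t` is drawn
from `π`, and given that history and that action `a`, the reward has distribution `F a`. -/
structure IsBanditProcess (π : Strategy A) (F : A → Measure ℝ) (P : Measure Ω)
    (act : ℕ → Ω → A) (rew : ℕ → Ω → ℝ) : Prop where
  measurable_act : ∀ t, Measurable (act t)
  measurable_rew : ∀ t, Measurable (rew t)
  act_law : ∀ t a,
    P⟦act t ⁻¹' {a} | MeasurableSpace.comap (hist act rew t) inferInstance⟧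
      =ᵐ[P] fun ω => (π t (hist act rew t ω)).1 a
  rew_law : ∀ t (B : Set ℝ), MeasurableSet B →
    P⟦rew t ⁻¹' B | MeasurableSpace.comap (fun ω => (hist act rew t ω, act t ω)) inferInstance⟧
      =ᵐ[P] fun ω => (F (act t ω)).real B

end Model

/-- The strategy `π` is perfectly risk-averse on the bandit problem with reward distributions `F`:
a dominant action is chosen with probability tending to one. -/
def PerfectlyRiskAverseOn {A : Type u} [Fintype A] [MeasurableSpace A]
    (π : Strategy A) (F : A → Measure ℝ) : Prop :=
  ∀ a, IsDominant F a →
    ∀ (Ω : Type v) [MeasurableSpace Ω] (P : Measure Ω) [IsProbabilityMeasure P]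
      (act : ℕ → Ω → A) (rew : ℕ → Ω → ℝ), IsBanditProcess π F P act rew →
      Tendsto (fun t => P.real {ω | act t ω = a}) atTop (𝓝 1)

end Bandit

/-! Once every action has been tried, almost surely the safe action has total reward 0 and every
other total is nonzero, since the other laws have no atoms. Greedy play then takes the safe action
exactly when no total is positive, so it suffices that a positive total is unlikely at a late round
`t`. Dominance gives the risky actions mean at most 0, and the absence of atoms gives `E[min(y,0)^2]
≥ k > 0`.

While some total is positive, a positive one is played with probability at least 1/2. Fix a deadline
`D`, put `r^2 = k(D - s)/4` at round `s`, and let `z` be the sum of the positive totals. As a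
function of `z`, `barrier (z / r)` is concave and nondecreasing: the mean does no harm, and the
curvature outweighs the growth `k/(4r^2)` due to the shrinking of `r`. For a fixed starting round
the barrier tends to 0 in expectation as `D → ∞`.

There are two leaks: a total that falls below 0 is truncated in `z`, and exploration can lift a
negative total above 0. Exploration costs cannot just be added up, because the rates have infinite
sum. Instead each action carries a `penalty` at the finer scale `c r`: it drops when the total falls
below 0, which pays for the truncation, and the amount still held pays for a return. Its convex tail
costs a term proportional to the exploration rate, covered by the decay of the penalty as `r`
shrinks. Hence `sum_integral_potential_le`, with no error to accumulate.

This needs `r` large, and a small barrier only says that `z` is small compared to `r`. So the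
potential is used until `T` rounds before `D`. On the last stretch, up to `t = D - n` with `T = N
n`, `shiftSum` adds `B = scale k n` to each positive total; giving up `B` on a fall below 0 absorbs
the truncation. Errors are now summed (`sum_integral_barrier_shiftSum_le`), which is harmless
because the exploration bound is chosen after `T`. At round `t` the scale equals `B`, so a positive
total makes the barrier 1 and the expectation bounds the probability. `eventually_le_measureReal`
combines the two stretches. -/

namespace Bandit

/-! ### Barrier and penalty: scalar inequalities -/

/-- The concave barrier `1 - (1 - q)₊ ^ 2`. -/
noncomputable def barrier (q : ℝ) : ℝ := 1 - (max (1 - q) 0) ^ 2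

/-- The penalty for an action whose total reward is `-u` in a suitable scale. -/
noncomputable def penalty (u : ℝ) : ℝ :=
  if u ≤ 0 then 5 else if u ≤ 1 then 5 - u - u ^ 2 else 3 / u

theorem barrier_le_one (q : ℝ) : barrier q ≤ 1 := by
  unfold barrier; nlinarith [sq_nonneg (max (1 - q) 0)]

theorem barrier_of_one_le {q : ℝ} (hq : 1 ≤ q) : barrier q = 1 := by
  unfold barrier; rw [max_eq_right (by linarith)]; ring

theorem barrier_of_le_one {q : ℝ} (hq : q ≤ 1) : barrier q = 1 - (1 - q) ^ 2 := by
  unfold barrier; rw [max_eq_left (by linarith)]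

theorem barrier_zero : barrier 0 = 0 := by
  rw [barrier_of_le_one zero_le_one]; ring

theorem barrier_mono : Monotone barrier := by
  intro a b hab
  unfold barrier
  have h1 : max (1 - b) 0 ≤ max (1 - a) 0 := max_le_max (by linarith) le_rfl
  have h2 : 0 ≤ max (1 - b) 0 := le_max_right _ _
  nlinarith

theorem barrier_nonneg {q : ℝ} (hq : 0 ≤ q) : 0 ≤ barrier q :=
  barrier_zero ▸ barrier_mono hq

theorem measurable_barrier : Measurable barrier := barrier_mono.measurable

/-- The barrier lies below its tangents. -/
theorem barrier_add_le {q : ℝ} (hq : q ≤ 1) (x : ℝ) :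
    barrier (q + x) ≤ barrier q + 2 * (1 - q) * x := by
  rw [barrier_of_le_one hq]
  rcases le_total (q + x) 1 with h | h
  · rw [barrier_of_le_one h]; nlinarith [sq_nonneg x]
  · rw [barrier_of_one_le h]; nlinarith

/-- The exact term `-x ^ 2` for downward moves is the source of the gain from curvature. -/
theorem barrier_add_eq {q x : ℝ} (hq : q ≤ 1) (hx : x ≤ 0) :
    barrier (q + x) = barrier q + 2 * (1 - q) * x - x ^ 2 := by
  rw [barrier_of_le_one hq, barrier_of_le_one (by linarith)]; ring

theorem barrier_add_le_lipschitz {q x : ℝ} (hq : 0 ≤ q) (hx : 0 ≤ x) :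
    barrier (q + x) ≤ barrier q + 2 * x := by
  rcases le_total q 1 with h | h
  · have := barrier_add_le h x
    nlinarith
  · rw [barrier_of_one_le h, barrier_of_one_le (by linarith)]; linarith

/-- The price of time: with `q = z / r'` and `l = r' / r`, shrinking the scale raises the barrier by
at most `(r ^ 2 - r' ^ 2) / r ^ 2`. -/
theorem barrier_le_rescale {q l : ℝ} (hq : 0 ≤ q) (h0 : 0 ≤ l) (h1 : l ≤ 1) :
    barrier q ≤ barrier (l * q) + (1 - l ^ 2) := by
  rcases le_total (l * q) 1 with h | h
  · rw [barrier_of_le_one h]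
    rcases le_total q 1 with h' | h'
    · rw [barrier_of_le_one h']
      nlinarith [sq_nonneg (q - 1), mul_nonneg hq (sub_nonneg.2 h1), mul_nonneg h0 hq,
        mul_nonneg (sub_nonneg.2 h1) (sq_nonneg (q - 1)),
        mul_nonneg (mul_nonneg h0 (sub_nonneg.2 h1)) (sq_nonneg q)]
    · rw [barrier_of_one_le h']
      have : 1 - l * q ≤ 1 - l := by nlinarith
      nlinarith
  · rw [barrier_of_one_le h]
    have := barrier_le_one q
    nlinarith

theorem penalty_of_nonpos {u : ℝ} (hu : u ≤ 0) : penalty u = 5 := by simp [penalty, hu]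

theorem penalty_of_le_one {u : ℝ} (h0 : 0 ≤ u) (h1 : u ≤ 1) : penalty u = 5 - u - u ^ 2 := by
  unfold penalty
  split_ifs with h
  · have : u = 0 := le_antisymm h h0
    simp [this]
  · rfl

theorem penalty_of_one_le {u : ℝ} (h1 : 1 ≤ u) : penalty u = 3 / u := by
  unfold penalty
  split_ifs with h h'
  · linarith
  · have : u = 1 := le_antisymm h' h1
    rw [this]; norm_num
  · rfl

theorem penalty_le (u : ℝ) : penalty u ≤ 5 := by
  rcases le_total u 0 with h | h
  · rw [penalty_of_nonpos h]
  rcases le_total u 1 with h' | h'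
  · rw [penalty_of_le_one h h']; nlinarith
  · rw [penalty_of_one_le h', div_le_iff₀ (by linarith)]; linarith

theorem penalty_nonneg (u : ℝ) : 0 ≤ penalty u := by
  rcases le_total u 0 with h | h
  · rw [penalty_of_nonpos h]; norm_num
  rcases le_total u 1 with h' | h'
  · rw [penalty_of_le_one h h']; nlinarith
  · rw [penalty_of_one_le h']; positivity

theorem measurable_penalty : Measurable penalty := by
  unfold penalty
  refine Measurable.ite measurableSet_Iic measurable_const
    (Measurable.ite measurableSet_Iic (by fun_prop) (by fun_prop))

/-- The income from time. The tail `3 / u` is chosen so that this margin decays like `1 / u`, as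
does the cost in `penalty_sub_le_of_large`. -/
theorem add_one_sub_div_le_penalty {u l : ℝ} (hl : 1 / 2 ≤ l) (hl1 : l ≤ 1) (hu : 1 / 2 ≤ u) :
    penalty u + (1 - l) / (4 * u) ≤ penalty (l * u) := by
  have hu0 : 0 < u := by linarith
  have hlu : 0 < l * u := by nlinarith
  have hd : (1 - l) / (4 * u) ≤ (1 - l) * u := by
    rw [div_le_iff₀ (by linarith)]
    have : 1 ≤ 4 * u * u := by nlinarith
    nlinarith [sub_nonneg.2 hl1]
  rcases le_total u 1 with h | h
  · have hlu1 : l * u ≤ u := by nlinarith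
    rw [penalty_of_le_one hu0.le h, penalty_of_le_one hlu.le (by linarith)]
    nlinarith
  · rw [penalty_of_one_le h]
    rcases le_total (l * u) 1 with h' | h'
    · rw [penalty_of_le_one hlu.le h']
      have h3 : 3 / u ≤ 3 - (u - 1) := by
        rw [div_le_iff₀ hu0]
        nlinarith
      nlinarith
    · rw [penalty_of_one_le h']
      have e : 3 / (l * u) - 3 / u = 3 * (1 - l) / (l * u) := by field_simp
      have e2 : (1 - l) / (4 * u) ≤ 3 * (1 - l) / (l * u) := by
        apply div_le_div₀ <;> nlinarith
      linarith

theorem penalty_le_rescale {u l : ℝ} (hl : 0 ≤ l) (hl1 : l ≤ 1) :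
    penalty u ≤ penalty (l * u) := by
  rcases le_total u 0 with h | h
  · rw [penalty_of_nonpos h, penalty_of_nonpos (by nlinarith)]
  have hlu : 0 ≤ l * u := by positivity
  have hlu1 : l * u ≤ u := by nlinarith
  rcases le_total u 1 with h1 | h1
  · rw [penalty_of_le_one h h1, penalty_of_le_one hlu (by linarith)]
    nlinarith
  · rw [penalty_of_one_le h1]
    rcases le_total (l * u) 1 with h' | h'
    · rw [penalty_of_le_one hlu h']
      have : 3 / u ≤ 3 := by rw [div_le_iff₀ (by linarith)]; linarith
      nlinarith
    · rw [penalty_of_one_le h']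
      apply div_le_div_of_nonneg_left <;> linarith

/-- The parabola `5 - v - v ^ 2` supplies the linear and quadratic terms. If the total turns
positive by `w = x - u ≤ 1/2`, then `5 + w / 2 ≤ 5 + w - w ^ 2`: the kink of the penalty at 0 leaves
room for the rise of the barrier, which is the term `max (x - u) 0 / 2`. The quartic term covers
`|x| ≥ 1/2`. -/
theorem penalty_sub_le_of_small {u x : ℝ} (h0 : 0 < u) (hu : u ≤ 1 / 2) :
    penalty (u - x) + max (x - u) 0 / 2
      ≤ penalty u + (1 + 2 * u) * x - x ^ 2 + 104 * x ^ 4 := by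
  rw [penalty_of_le_one h0.le (by linarith)]
  rcases le_total |x| (1 / 2) with h | h
  · obtain ⟨h1, h2⟩ := abs_le.1 h
    have hx4 : 0 ≤ x ^ 4 := by positivity
    rcases le_total x u with h3 | h3
    · rw [penalty_of_le_one (by linarith) (by linarith), max_eq_right (by linarith)]
      nlinarith
    · rw [penalty_of_nonpos (by linarith), max_eq_left (by linarith)]
      nlinarith
  · have hm : max (x - u) 0 ≤ |x| := max_le (by linarith [le_abs_self x]) (abs_nonneg x)
    have hp := penalty_le (u - x)
    have e2 : x ^ 2 = |x| ^ 2 := (sq_abs x).symm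
    have e4 : x ^ 4 = |x| ^ 4 := by rw [← abs_pow, abs_of_nonneg (by positivity)]
    have hx : -(2 * |x|) ≤ (1 + 2 * u) * x := by
      have := neg_abs_le x
      have := le_abs_self x
      nlinarith [abs_nonneg x]
    rw [e2, e4]
    set w := |x|
    have h2 : 1 ≤ 4 * w ^ 2 := by nlinarith
    have h3 : w ^ 2 ≤ 4 * w ^ 4 := by nlinarith [sq_nonneg w]
    have h4 : w ≤ 2 * w ^ 2 := by nlinarith
    nlinarith

/-- Away from 0 the convex tail forces a second-order error. The slope `l` is minus the derivative
of the penalty at `u`; only its sign matters later, as the mean is at most 0. -/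
theorem penalty_sub_le_of_large {u : ℝ} (hu : 1 / 2 ≤ u) :
    ∃ l, 0 ≤ l ∧ ∀ x, penalty (u - x) + max (x - u) 0 / 2
      ≤ penalty u + l * x + 48 * x ^ 2 / u := by
  have hu0 : 0 < u := by linarith
  -- For `|x| ≥ u / 2` the error `x ^ 2 / u` is at least `|x| / 2` and dominates every other term.
  have far : ∀ l, 0 ≤ l → l ≤ 3 → ∀ x, u / 2 ≤ |x| →
      penalty (u - x) + max (x - u) 0 / 2 ≤ penalty u + l * x + 48 * x ^ 2 / u := by
    intro l hl hl3 x hx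
    have hm : max (x - u) 0 ≤ |x| := max_le (by linarith [le_abs_self x]) (abs_nonneg x)
    have hp := penalty_le (u - x)
    have hp' := penalty_nonneg u
    have hlx : -(3 * |x|) ≤ l * x := by
      have := neg_abs_le x
      nlinarith [abs_nonneg x]
    have hq : |x| / 2 ≤ x ^ 2 / u := by
      rw [le_div_iff₀ hu0, ← sq_abs x]
      nlinarith [abs_nonneg x]
    have hx4 : 1 / 4 ≤ |x| := by linarith
    rw [mul_div_assoc]
    linarith
  rcases le_total u 1 with h1 | h1
  · refine ⟨1 + 2 * u, by linarith, fun x => ?_⟩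
    rcases le_total (u / 2) |x| with hx | hx
    · exact far _ (by linarith) (by linarith) x hx
    obtain ⟨hx1, hx2⟩ := abs_le.1 hx
    have hq : x ^ 2 ≤ x ^ 2 / u := by
      rw [le_div_iff₀ hu0]; nlinarith [sq_nonneg x]
    rw [max_eq_right (by linarith), penalty_of_le_one hu0.le h1, mul_div_assoc]
    rcases le_total (u - x) 1 with h | h
    · rw [penalty_of_le_one (by linarith) h]
      nlinarith [sq_nonneg x]
    · rw [penalty_of_one_le h]
      -- Both branches of the penalty have value 3 and slope -3 at 1, so they differ there only to
      -- second order.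
      have key : 3 / (u - x) ≤ 5 - (u - x) - (u - x) ^ 2 + 4 * (u - x - 1) ^ 2 := by
        rw [div_le_iff₀ (by linarith)]
        nlinarith [mul_nonneg (sub_nonneg.2 h) (sq_nonneg (u - x - 1))]
      have : (u - x - 1) ^ 2 ≤ x ^ 2 := by
        exact pow_le_pow_left₀ (by linarith) (by linarith) 2 |>.trans_eq (neg_sq x)
      nlinarith
  · refine ⟨3 / u ^ 2, by positivity, fun x => ?_⟩
    have hl3 : 3 / u ^ 2 ≤ 3 := by
      rw [div_le_iff₀ (by positivity)]; nlinarith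
    rcases le_total (u / 2) |x| with hx | hx
    · exact far _ (by positivity) hl3 x hx
    obtain ⟨hx1, hx2⟩ := abs_le.1 hx
    have hux : 0 < u - x := by linarith
    rw [max_eq_right (by linarith), penalty_of_one_le h1]
    have hle : penalty (u - x) ≤ 3 / (u - x) := by
      rcases le_total (u - x) 1 with h | h
      · rw [penalty_of_le_one hux.le h, le_div_iff₀ hux]
        nlinarith [mul_nonneg (by linarith : 0 ≤ u - x + 3) (sq_nonneg (u - x - 1))]
      · rw [penalty_of_one_le h]
    have e : 3 / (u - x) = 3 / u + 3 / u ^ 2 * x + 3 * x ^ 2 / (u ^ 2 * (u - x)) := by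
      field_simp; ring
    have : 3 * x ^ 2 / (u ^ 2 * (u - x)) ≤ 48 * x ^ 2 / u := by
      rw [div_le_div_iff₀ (by positivity) hu0]
      have : 1 / 2 ≤ u - x := by linarith
      have : u ≤ u ^ 2 := by nlinarith
      have : u ≤ 2 * (u ^ 2 * (u - x)) := by nlinarith
      nlinarith [sq_nonneg x]
    linarith

/-! ### Falling below zero: truncation against penalty or shift -/

/-- Beyond `b` the fourth-power terms beat both `x ^ 2` and `2 * |x|`, so long downward jumps are
charged to the fourth moment. -/
theorem tail_bound {b x q : ℝ} (hb : 0 < b) (hq : 0 ≤ q) (hx : x < -b) :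
    0 ≤ 2 * (1 - q) * x - (min x 0) ^ 2 + x ^ 4 / b ^ 2 + 2 * x ^ 4 / b ^ 3 := by
  rw [min_eq_left (by linarith)]
  have h1 : x ^ 2 ≤ x ^ 4 / b ^ 2 := by
    rw [le_div_iff₀ (by positivity)]
    have : b ^ 2 ≤ x ^ 2 := by nlinarith
    nlinarith [sq_nonneg x]
  have h2 : -x ≤ x ^ 4 / b ^ 3 := by
    rw [le_div_iff₀ (by positivity)]
    have : b ^ 3 ≤ (-x) ^ 3 := pow_le_pow_left₀ hb.le (by linarith) 3
    nlinarith
  rw [mul_div_assoc]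
  nlinarith

/-- One reward of a positive action, in units of `r`. Truncation at 0 matters only if `p + x < 0`;
the drop of the penalty from 5 repays it when `x ≥ -d`, and `tail_bound` does otherwise. -/
theorem barrier_add_penalty_le {q p x c d : ℝ} (hp : 0 < p) (hpq : p ≤ q) (hq : q ≤ 1)
    (hd : 0 < d) (hdc : d ≤ c) (hc : c ≤ 1) :
    barrier (q - p + max (p + x) 0) + 4 * c * penalty (-(p + x) / d)
      ≤ barrier q + 20 * c + 2 * (1 - q) * x - (min x 0) ^ 2 + x ^ 4 / d ^ 2
        + 2 * x ^ 4 / d ^ 3 := by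
  have hc0 : 0 < c := by linarith
  have hpen := penalty_le (-(p + x) / d)
  have hpos1 : 0 ≤ x ^ 4 / d ^ 2 := by positivity
  have hpos2 : 0 ≤ 2 * x ^ 4 / d ^ 3 := by positivity
  have hpc : 4 * c * penalty (-(p + x) / d) ≤ 20 * c := by nlinarith
  rcases le_total 0 x with hx | hx
  · rw [min_eq_right hx, max_eq_left (by linarith)]
    have := barrier_add_le hq x
    rw [show q - p + (p + x) = q + x by ring]
    linarith
  rcases le_total 0 (p + x) with h | h
  · rw [min_eq_left hx, max_eq_left h, show q - p + (p + x) = q + x by ring,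
      barrier_add_eq hq hx]
    linarith
  rw [max_eq_right h, add_zero]
  rcases lt_or_ge x (-d) with h' | h'
  · have := tail_bound hd (by linarith : 0 ≤ q) h'
    have : barrier (q - p) ≤ barrier q := barrier_mono (by linarith)
    linarith
  -- Having `q - p` in place of `q + x` costs `-(p + x)` times `2 * (1 - q) + p - x ≤ 4`; this is
  -- the origin of the factor 4 in `4 * c`, and `d ≤ c` makes the drop of the penalty large enough.
  · rw [min_eq_left hx, sub_eq_add_neg q p, barrier_add_eq hq (by linarith)]
    have hv : 0 ≤ -(p + x) / d := div_nonneg (by linarith) hd.le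
    have hv1 : -(p + x) / d ≤ 1 := by rw [div_le_one hd]; linarith
    rw [penalty_of_le_one hv hv1]
    have h4 : -(p + x) ≤ c * (-(p + x) / d) := by
      rw [mul_div_assoc', le_div_iff₀ hd]; nlinarith
    have h5 : 0 ≤ c * (-(p + x) / d) ^ 2 := by positivity
    nlinarith

/-- No penalty is needed here: a fall to 0 or below forfeits `p + d`, which is at least `-x` unless
`x < -d`, the case of `tail_bound`. -/
theorem barrier_shift_le {q p x d y : ℝ} (hp : 0 < p) (hpq : p + d ≤ q) (hq : q ≤ 1)
    (hd : 0 < d) (hy : y = if 0 < p + x then p + x + d else 0) :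
    barrier (q - (p + d) + y)
      ≤ barrier q + 2 * (1 - q) * x - (min x 0) ^ 2 + x ^ 4 / d ^ 2 + 2 * x ^ 4 / d ^ 3 := by
  have hpos1 : 0 ≤ x ^ 4 / d ^ 2 := by positivity
  have hpos2 : 0 ≤ 2 * x ^ 4 / d ^ 3 := by positivity
  subst hy
  rcases le_total 0 x with hx | hx
  · rw [min_eq_right hx, if_pos (by linarith), show q - (p + d) + (p + x + d) = q + x by ring]
    have := barrier_add_le hq x
    linarith
  rw [min_eq_left hx]
  have hexact := barrier_add_eq hq hx
  split_ifs with h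
  · rw [show q - (p + d) + (p + x + d) = q + x by ring]
    linarith
  rcases lt_or_ge x (-d) with h' | h'
  · have := tail_bound hd (by linarith : 0 ≤ q) h'
    rw [min_eq_left hx] at this
    have : barrier (q - (p + d) + 0) ≤ barrier q := barrier_mono (by linarith)
    linarith
  · have : barrier (q - (p + d) + 0) ≤ barrier (q + x) := barrier_mono (by linarith)
    linarith

/-! ### Integrating the scalar inequalities -/

/-- Bounds on the mean and on the second and fourth moments of a reward distribution. -/
structure MomentBounds (k m M : ℝ) (ν : Measure ℝ) : Prop where
  integrable_id : Integrable (fun x : ℝ => x) ν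
  integrable_sq : Integrable (fun x : ℝ => x ^ 2) ν
  integrable_pow_four : Integrable (fun x : ℝ => x ^ 4) ν
  mean_nonpos : ∫ x, x ∂ν ≤ 0
  le_lower_sq : k ≤ ∫ x, (min x 0) ^ 2 ∂ν
  sq_le : ∫ x, x ^ 2 ∂ν ≤ m
  pow_four_le : ∫ x, x ^ 4 ∂ν ≤ M

theorem min_zero_sq_le (x : ℝ) : (min x 0) ^ 2 ≤ x ^ 2 := by
  rcases le_total x 0 with h | h
  · rw [min_eq_left h]
  · rw [min_eq_right h]; nlinarith [sq_nonneg x]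

theorem MomentBounds.integrable_lower_sq {k m M : ℝ} {ν : Measure ℝ} (h : MomentBounds k m M ν) :
    Integrable (fun x : ℝ => (min x 0) ^ 2) ν := by
  refine h.integrable_sq.mono' (by fun_prop) (Eventually.of_forall fun x => ?_)
  rw [Real.norm_of_nonneg (by positivity)]
  exact min_zero_sq_le x

theorem MomentBounds.integral_le_quartic {k m M : ℝ} {ν : Measure ℝ} [IsProbabilityMeasure ν]
    (h : MomentBounds k m M ν) {G : ℝ → ℝ} (hG : Integrable G ν) {C l α β : ℝ} (hl : 0 ≤ l)
    (hα : 0 ≤ α) (hβ : 0 ≤ β)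
    (hle : ∀ y, G y ≤ C + l * y - α * (min y 0) ^ 2 + β * y ^ 4) :
    ∫ y, G y ∂ν ≤ C - α * k + β * M := by
  have i1 := h.integrable_id.const_mul l
  have i2 := h.integrable_lower_sq.const_mul α
  have i3 := h.integrable_pow_four.const_mul β
  have i0 : Integrable (fun _ : ℝ => C) ν := integrable_const C
  have := integral_mono hG (((i0.add i1).sub i2).add i3) hle
  rw [integral_add' ((i0.add i1).sub i2) i3, integral_sub' (i0.add i1) i2, integral_add' i0 i1,
    integral_const_mul, integral_const_mul, integral_const_mul, integral_const] at this
  simp only [probReal_univ, one_smul] at this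
  nlinarith [mul_nonneg hl (neg_nonneg.2 h.mean_nonpos),
    mul_le_mul_of_nonneg_left h.le_lower_sq hα, mul_le_mul_of_nonneg_left h.pow_four_le hβ]

theorem MomentBounds.integral_le_quadratic {k m M : ℝ} {ν : Measure ℝ} [IsProbabilityMeasure ν]
    (h : MomentBounds k m M ν) {G : ℝ → ℝ} (hG : Integrable G ν) {C l α : ℝ} (hl : 0 ≤ l)
    (hα : 0 ≤ α) (hle : ∀ y, G y ≤ C + l * y + α * y ^ 2) :
    ∫ y, G y ∂ν ≤ C + α * m := by
  have i1 := h.integrable_id.const_mul l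
  have i2 := h.integrable_sq.const_mul α
  have i0 : Integrable (fun _ : ℝ => C) ν := integrable_const C
  have := integral_mono hG ((i0.add i1).add i2) hle
  rw [integral_add' (i0.add i1) i2, integral_add' i0 i1,
    integral_const_mul, integral_const_mul, integral_const] at this
  simp only [probReal_univ, one_smul] at this
  nlinarith [mul_nonneg hl (neg_nonneg.2 h.mean_nonpos), mul_le_mul_of_nonneg_left h.sq_le hα]

/-! ### The potential and its one-round decrease -/

variable {A : Type*}

open Classical in
/-- The vector of total rewards after the reward `y` of action `a`. -/
noncomputable def addReward (x : A → ℝ) (a : A) (y : ℝ) : A → ℝ :=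
  fun b => x b + if b = a then y else 0

theorem addReward_zero (x : A → ℝ) (a : A) : addReward x a 0 = x := by
  funext b; simp [addReward]

theorem measurable_addReward (x : A → ℝ) (a : A) : Measurable (addReward x a) := by
  unfold addReward
  refine measurable_pi_lambda _ fun b => ?_
  by_cases h : b = a
  · simpa [h] using measurable_id.const_add (x a)
  · simp [h]

variable [Fintype A]

theorem sum_addReward (g : ℝ → ℝ) (x : A → ℝ) (a : A) (y : ℝ) :
    ∑ b, g (addReward x a y b) = ∑ b, g (x b) - g (x a) + g (x a + y) := by
  classical
  have h1 := Finset.add_sum_erase Finset.univ (fun b => g (addReward x a y b)) (Finset.mem_univ a)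
  have h2 := Finset.add_sum_erase Finset.univ (fun b => g (x b)) (Finset.mem_univ a)
  have h3 : ∑ b ∈ Finset.univ.erase a, g (addReward x a y b)
      = ∑ b ∈ Finset.univ.erase a, g (x b) := by
    refine Finset.sum_congr rfl fun b hb => ?_
    simp [addReward, Finset.ne_of_mem_erase hb]
  have h4 : addReward x a y a = x a + y := by simp [addReward]
  simp only [h4] at h1
  linarith

/-- The sum of the positive parts. -/
noncomputable def posSum (x : A → ℝ) : ℝ := ∑ b, max (x b) 0

theorem posSum_nonneg (x : A → ℝ) : 0 ≤ posSum x :=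
  Finset.sum_nonneg fun _ _ => le_max_right _ _

theorem le_posSum (x : A → ℝ) (a : A) : x a ≤ posSum x :=
  (le_max_left _ _).trans
    (Finset.single_le_sum (f := fun b => max (x b) 0) (fun _ _ => le_max_right _ _)
      (Finset.mem_univ a))

theorem posSum_eq_zero {x : A → ℝ} (h : ∀ b, x b ≤ 0) : posSum x = 0 :=
  Finset.sum_eq_zero fun b _ => max_eq_right (h b)

theorem measurable_posSum : Measurable (posSum : (A → ℝ) → ℝ) := by
  unfold posSum
  fun_prop

/-- The potential of a vector of total rewards: `r` is the scale of the positive total rewards,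
`s` that of the negative ones. -/
noncomputable def potential (r s c : ℝ) (x : A → ℝ) : ℝ :=
  barrier (posSum x / r) + 4 * c * ∑ b, penalty (-(x b) / s)

theorem measurable_potential (r s c : ℝ) : Measurable (potential r s c : (A → ℝ) → ℝ) := by
  unfold potential
  refine (measurable_barrier.comp (measurable_posSum.div_const r)).add
    (Measurable.const_mul (Finset.measurable_sum _ fun b _ => ?_) _)
  exact measurable_penalty.comp (by fun_prop)

theorem sum_penalty_le (s : ℝ) (x : A → ℝ) :
    ∑ b, penalty (-(x b) / s) ≤ 5 * Fintype.card A := by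
  have := Finset.sum_le_sum (s := (Finset.univ : Finset A)) fun b _ => penalty_le (-(x b) / s)
  simpa [mul_comm] using this

theorem potential_nonneg {r s c : ℝ} (hr : 0 ≤ r) (hc : 0 ≤ c) (x : A → ℝ) :
    0 ≤ potential r s c x :=
  add_nonneg (barrier_nonneg (div_nonneg (posSum_nonneg x) hr))
    (mul_nonneg (by positivity) (Finset.sum_nonneg fun _ _ => penalty_nonneg _))

theorem potential_le {r s c : ℝ} (hc : 0 ≤ c) (x : A → ℝ) :
    potential r s c x ≤ barrier (posSum x / r) + 20 * c * Fintype.card A := by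
  have := mul_le_mul_of_nonneg_left (sum_penalty_le s x) (by positivity : 0 ≤ 4 * c)
  unfold potential
  linarith

theorem abs_potential_le {r s c : ℝ} (hr : 0 ≤ r) (hc : 0 ≤ c) (x : A → ℝ) :
    |potential r s c x| ≤ 1 + 20 * c * Fintype.card A := by
  rw [abs_of_nonneg (potential_nonneg hr hc x)]
  linarith [potential_le (r := r) (s := s) hc x, barrier_le_one (posSum x / r)]

theorem integrable_potential {r s c : ℝ} (hr : 0 ≤ r) (hc : 0 ≤ c) (x : A → ℝ) (a : A)
    (ν : Measure ℝ) [IsProbabilityMeasure ν] :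
    Integrable (fun y => potential r s c (addReward x a y)) ν :=
  Integrable.of_bound
    ((measurable_potential r s c).comp (measurable_addReward x a)).aestronglyMeasurable
    (1 + 20 * c * Fintype.card A) (Eventually.of_forall fun _ => abs_potential_le hr hc _)

theorem potential_addReward (r s c : ℝ) (x : A → ℝ) (a : A) (y : ℝ) :
    potential r s c (addReward x a y)
      = barrier ((posSum x - max (x a) 0 + max (x a + y) 0) / r)
        + 4 * c * (∑ b, penalty (-(x b) / s) - penalty (-(x a) / s) + penalty (-(x a + y) / s)) := by
  unfold potential posSum
  rw [sum_addReward (fun t => max t 0) x a y, sum_addReward (fun t => penalty (-t / s)) x a y]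

theorem barrier_div_le {r r' z : ℝ} (hr' : 0 < r') (hrr : r' ≤ r) (hz : 0 ≤ z) :
    barrier (z / r') ≤ barrier (z / r) + (r ^ 2 - r' ^ 2) / r ^ 2 := by
  have hr : 0 < r := by linarith
  have := barrier_le_rescale (q := z / r') (l := r' / r) (by positivity) (by positivity)
    ((div_le_one hr).2 hrr)
  rw [show r' / r * (z / r') = z / r by field_simp] at this
  rw [sub_div, div_self (by positivity), ← div_pow]
  exact this

/-- Curvature gains `k / r ^ 2`; half of it is spent on the fourth-moment errors. The penalty scale
is already `c * r'` on both sides, so that the effect of time on the penalties stays separate. -/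
theorem integral_potential_le_of_pos {k m M r r' c : ℝ} {x : A → ℝ} {a : A} {ν : Measure ℝ}
    [IsProbabilityMeasure ν] (h : MomentBounds k m M ν) (hM : 0 ≤ M) (hxa : 0 < x a)
    (hr' : 0 < r') (hrr : r' ≤ r) (hr2 : r ≤ 2 * r') (hc : 0 < c) (hc1 : c ≤ 1)
    (hbig : 48 * M ≤ k * c ^ 3 * r ^ 2) (hz : posSum x ≤ r) :
    ∫ y, potential r' (c * r') c (addReward x a y) ∂ν
      ≤ potential r (c * r') c x + (r ^ 2 - r' ^ 2) / r ^ 2 - k / (2 * r ^ 2) := by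
  have hr : 0 < r := by linarith
  have hxz := le_posSum x a
  have hd : 0 < c * r' / r := by positivity
  have hdc : c * r' / r ≤ c := by rw [div_le_iff₀ hr]; nlinarith
  have key : ∀ y, potential r' (c * r') c (addReward x a y)
      ≤ (potential r (c * r') c x + (r ^ 2 - r' ^ 2) / r ^ 2)
        + (2 * (1 - posSum x / r) / r) * y - (1 / r ^ 2) * (min y 0) ^ 2
        + (1 / (r ^ 4 * (c * r' / r) ^ 2) + 2 / (r ^ 4 * (c * r' / r) ^ 3)) * y ^ 4 := by
    intro y
    have h1 := barrier_add_penalty_le (q := posSum x / r) (p := x a / r) (x := y / r) (c := c)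
      (d := c * r' / r) (by positivity) (by gcongr) ((div_le_one hr).2 hz) hd hdc hc1
    have hm : min (y / r) 0 = min y 0 / r := by
      rw [← min_div_div_right hr.le, zero_div]
    have hmx : max (x a / r + y / r) 0 = max (x a + y) 0 / r := by
      rw [← add_div, ← max_div_div_right hr.le, zero_div]
    rw [hm, hmx] at h1
    have hq : posSum x / r - x a / r + max (x a + y) 0 / r
        = (posSum x - x a + max (x a + y) 0) / r := by ring
    have hpp : -(x a / r + y / r) / (c * r' / r) = -(x a + y) / (c * r') := by
      field_simp
    rw [hq, hpp] at h1
    have hzz : 0 ≤ posSum x - x a + max (x a + y) 0 := by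
      have := le_max_right (x a + y) 0
      linarith
    have h2 := barrier_div_le hr' hrr hzz
    rw [potential_addReward, max_eq_left hxa.le, penalty_of_nonpos (u := -(x a) / (c * r'))
      (div_nonpos_of_nonpos_of_nonneg (by linarith) (by positivity))]
    unfold potential
    have e1 : (y / r) ^ 4 / (c * r' / r) ^ 2 + 2 * (y / r) ^ 4 / (c * r' / r) ^ 3
        = (1 / (r ^ 4 * (c * r' / r) ^ 2) + 2 / (r ^ 4 * (c * r' / r) ^ 3)) * y ^ 4 := by
      rw [div_pow]; field_simp
    have e2 : (min y 0 / r) ^ 2 = (1 / r ^ 2) * (min y 0) ^ 2 := by rw [div_pow]; ring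
    have e3 : 2 * (1 - posSum x / r) * (y / r) = (2 * (1 - posSum x / r) / r) * y := by ring
    linarith
  have hq1 : posSum x / r ≤ 1 := (div_le_one hr).2 hz
  have := h.integral_le_quartic (integrable_potential hr'.le hc.le x a ν)
    (div_nonneg (by linarith) hr.le) (by positivity) (by positivity) key
  refine this.trans ?_
  -- From `d ≥ c / 2` the error is at most `24 * M / (c ^ 3 * r ^ 4)`, whence the constant 48 in
  -- `hbig`.
  have hd2 : c / 2 ≤ c * r' / r := by rw [div_le_div_iff₀ two_pos hr]; nlinarith
  set d := c * r' / r
  have hfin : (1 / (r ^ 4 * d ^ 2) + 2 / (r ^ 4 * d ^ 3)) * M ≤ k / (2 * r ^ 2) := by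
    have hd1 : d ≤ 1 := hdc.trans hc1
    have e : 1 / (r ^ 4 * d ^ 2) ≤ 1 / (r ^ 4 * d ^ 3) := by
      apply one_div_le_one_div_of_le (by positivity)
      apply mul_le_mul_of_nonneg_left _ (by positivity)
      exact pow_le_pow_of_le_one hd.le hd1 (by norm_num)
    have e' : (1 / (r ^ 4 * d ^ 2) + 2 / (r ^ 4 * d ^ 3)) ≤ 3 / (r ^ 4 * d ^ 3) := by
      have : 3 / (r ^ 4 * d ^ 3) = 1 / (r ^ 4 * d ^ 3) + 2 / (r ^ 4 * d ^ 3) := by ring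
      linarith
    refine (mul_le_mul_of_nonneg_right e' hM).trans ?_
    rw [div_mul_eq_mul_div, div_le_div_iff₀ (by positivity) (by positivity)]
    have hd3 : c ^ 3 ≤ 8 * d ^ 3 := by
      have := pow_le_pow_left₀ (by positivity) hd2 3
      linarith [show (c / 2) ^ 3 = c ^ 3 / 8 by ring]
    have hk : 0 ≤ k := by
      by_contra hk
      have : k * c ^ 3 * r ^ 2 < 0 :=
        mul_neg_of_neg_of_pos (mul_neg_of_neg_of_pos (not_le.1 hk) (by positivity)) (by positivity)
      linarith
    have h6 : 6 * M ≤ k * r ^ 2 * d ^ 3 := by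
      nlinarith [mul_le_mul_of_nonneg_left hd3 (by positivity : 0 ≤ k * r ^ 2)]
    nlinarith [mul_le_mul_of_nonneg_right h6 (by positivity : 0 ≤ r ^ 2)]
  have : k / (2 * r ^ 2) = 1 / r ^ 2 * k - k / (2 * r ^ 2) := by field_simp; ring
  linarith

/-- The barrier is 2-Lipschitz on `[0, ∞)`, so a return above 0 raises it by at most `4 * c` times
`max (y / s - u) 0 / 2`, the extra term in the penalty estimates. Near 0 the curvature of the
penalty cancels the quartic error; only `u ≥ 1/2` leaves a cost. -/
theorem integral_potential_le_of_neg {k m M r s c : ℝ} {x : A → ℝ} {a : A} {ν : Measure ℝ}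
    [IsProbabilityMeasure ν] (h : MomentBounds k m M ν) (hxa : x a < 0)
    (hr : 0 < r) (hc : 0 < c) (hs : s = c * r) (hbig : 104 * M ≤ k * s ^ 2) :
    ∫ y, potential r s c (addReward x a y) ∂ν
      ≤ potential r s c x
        + 4 * c * (if 1 / 2 ≤ -(x a) / s then 48 * m / s ^ 2 / (-(x a) / s) else 0) := by
  have hs0 : 0 < s := by rw [hs]; positivity
  set u := -(x a) / s with hu
  have hu0 : 0 < u := div_pos (by linarith) hs0
  have key : ∀ y, potential r s c (addReward x a y) ≤ potential r s c x
      + 4 * c * (penalty (u - y / s) + max (y / s - u) 0 / 2 - penalty u) := by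
    intro y
    rw [potential_addReward, max_eq_right hxa.le, sub_zero, ← hu]
    have e1 : -(x a + y) / s = u - y / s := by rw [hu]; ring
    have e2 : max (x a + y) 0 / r = c * max (y / s - u) 0 := by
      have : y / s - u = (x a + y) / s := by rw [hu]; ring
      have h0 : max ((x a + y) / s) 0 = max (x a + y) 0 / s := by
        rw [← max_div_div_right hs0.le, zero_div]
      rw [this, h0, hs]
      field_simp
    have h1 := barrier_add_le_lipschitz (q := posSum x / r) (x := max (x a + y) 0 / r)
      (div_nonneg (posSum_nonneg x) hr.le) (div_nonneg (le_max_right _ _) hr.le)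
    rw [← add_div, e2] at h1
    rw [e1]
    unfold potential
    linarith
  have hint := integrable_potential (s := s) hr.le hc.le x a ν
  split_ifs with h2
  · obtain ⟨l, hl, hle⟩ := penalty_sub_le_of_large h2
    have := h.integral_le_quadratic hint (C := potential r s c x) (l := 4 * c * l / s)
      (α := 4 * c * (48 / (s ^ 2 * u))) (by positivity) (by positivity) (fun y => by
        refine (key y).trans ?_
        have := mul_le_mul_of_nonneg_left (hle (y / s)) (by positivity : 0 ≤ 4 * c)
        have e : 48 * (y / s) ^ 2 / u = 48 / (s ^ 2 * u) * y ^ 2 := by field_simp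
        have e' : 4 * c * l / s * y = 4 * c * (l * (y / s)) := by ring
        rw [e] at this
        linarith)
    refine this.trans_eq ?_
    field_simp
  · have := h.integral_le_quartic hint (C := potential r s c x) (l := 4 * c * (1 + 2 * u) / s)
      (α := 4 * c / s ^ 2) (β := 4 * c * 104 / s ^ 4) (by positivity) (by positivity)
      (by positivity) (fun y => by
        refine (key y).trans ?_
        have h3 := penalty_sub_le_of_small (x := y / s) hu0 (not_le.1 h2).le
        have h4 : (min y 0) ^ 2 / s ^ 2 ≤ (y / s) ^ 2 := by
          rw [div_pow]; gcongr ?_ / _; exact min_zero_sq_le y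
        have := mul_le_mul_of_nonneg_left (h3.trans (b := _) (c := penalty u + (1 + 2 * u) * (y / s)
          - (min y 0) ^ 2 / s ^ 2 + 104 * (y / s) ^ 4) (by linarith)) (by positivity : 0 ≤ 4 * c)
        have e : 4 * c * 104 / s ^ 4 * y ^ 4 = 4 * c * (104 * (y / s) ^ 4) := by
          rw [div_pow]; ring
        have e' : 4 * c * (1 + 2 * u) / s * y = 4 * c * ((1 + 2 * u) * (y / s)) := by ring
        have e'' : 4 * c / s ^ 2 * (min y 0) ^ 2 = 4 * c * ((min y 0) ^ 2 / s ^ 2) := by ring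
        linarith)
    refine this.trans ?_
    have : 4 * c * 104 / s ^ 4 * M ≤ 4 * c / s ^ 2 * k := by
      rw [div_mul_eq_mul_div, div_mul_eq_mul_div, div_le_div_iff₀ (by positivity) (by positivity)]
      nlinarith [mul_le_mul_of_nonneg_left hbig (by positivity : 0 ≤ 4 * c * s ^ 2)]
    linarith

/-- The exploration of an action with a negative total reward is paid for by the decrease of
the penalty with time. -/
theorem mul_penalty_le {e w k m r r' c t : ℝ} (hw0 : 0 ≤ w) (hw : w ≤ e) (hm : 0 ≤ m)
    (hk : 0 < k) (hc : 0 < c) (hr' : 0 < r') (hr2 : r ≤ 2 * r') (hkr : r ^ 2 - r' ^ 2 = k / 4)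
    (hr : 0 < r) (he : 6144 * e * m ≤ k * c ^ 2) :
    w * (if 1 / 2 ≤ t / (c * r') then 48 * m / (c * r') ^ 2 / (t / (c * r')) else 0)
      ≤ penalty (t / (c * r)) - penalty (t / (c * r')) := by
  have hrr : r' ≤ r := by nlinarith
  have hs' : 0 < c * r' := by positivity
  set u := t / (c * r') with hu
  have hl : t / (c * r) = r' / r * u := by rw [hu]; field_simp
  have hl1 : r' / r ≤ 1 := (div_le_one hr).2 hrr
  rw [hl]
  split_ifs with h
  · have h1 := add_one_sub_div_le_penalty (l := r' / r) (by rw [div_le_div_iff₀ two_pos hr]; linarith)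
      hl1 h
    refine le_trans ?_ (le_sub_iff_add_le'.2 h1)
    have hu0 : 0 < u := by linarith
    have h2 : k / (8 * r ^ 2) ≤ 1 - r' / r := by
      rw [one_sub_div hr.ne', div_le_div_iff₀ (by positivity) hr]
      have : k = 4 * (r - r') * (r + r') := by linarith [hkr, show (r - r') * (r + r') = r ^ 2 - r' ^ 2 by ring]
      rw [this]
      nlinarith [mul_nonneg (mul_nonneg (sub_nonneg.2 hrr) hr.le) (sub_nonneg.2 hrr)]
    have h3 : w * (48 * m / (c * r') ^ 2) ≤ (1 - r' / r) / 4 := by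
      -- Here `6144 = 48 * 32 * 4`, the last factor from `r ^ 2 ≤ 4 * r' ^ 2`.
      have : w * (48 * m / (c * r') ^ 2) ≤ k / (32 * r ^ 2) := by
        rw [mul_div_assoc', div_le_div_iff₀ (by positivity) (by positivity)]
        have hwm : 6144 * w * m ≤ k * c ^ 2 := by nlinarith [mul_le_mul_of_nonneg_right hw hm]
        have hrr4 : r ^ 2 ≤ 4 * r' ^ 2 := by nlinarith
        have hwm0 : 0 ≤ w * m := by positivity
        nlinarith [mul_le_mul_of_nonneg_left hrr4 hwm0,
          mul_le_mul_of_nonneg_right hwm (by positivity : 0 ≤ r' ^ 2)]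
      have : k / (32 * r ^ 2) = k / (8 * r ^ 2) / 4 := by field_simp; norm_num
      linarith
    calc w * (48 * m / (c * r') ^ 2 / u) = w * (48 * m / (c * r') ^ 2) / u := by ring
      _ ≤ ((1 - r' / r) / 4) / u := by gcongr
      _ = (1 - r' / r) / (4 * u) := by rw [div_div]
  · rw [mul_zero, sub_nonneg]
    exact penalty_le_rescale (by positivity) hl1

/-- The potential does not increase in a round of greedy play with rare exploration. -/
theorem sum_integral_potential_le {k m M r r' c e : ℝ} {x : A → ℝ} {F : A → Measure ℝ}
    [∀ a, IsProbabilityMeasure (F a)] {w : A → ℝ} (hk : 0 < k) (hm : 0 ≤ m) (hM : 0 ≤ M)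
    (hlaw : ∀ a, (x a = 0 ∧ F a = Measure.dirac 0) ∨ (x a ≠ 0 ∧ MomentBounds k m M (F a)))
    (hw0 : ∀ a, 0 ≤ w a) (hw1 : ∑ a, w a = 1) (hneg : ∀ a, x a < 0 → w a ≤ e)
    (hpos : ∀ b, 0 < x b → 1 / 2 ≤ ∑ a, if 0 < x a then w a else 0)
    (hr' : 0 < r') (hr2 : r ≤ 2 * r') (hkr : r ^ 2 - r' ^ 2 = k / 4) (hr : 0 < r)
    (hc : 0 < c) (hc1 : c ≤ 1) (he : 6144 * e * m ≤ k * c ^ 2)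
    (hbig : 48 * M ≤ k * c ^ 3 * r ^ 2) (hbig' : 104 * M ≤ k * (c * r') ^ 2) :
    ∑ a, w a * ∫ y, potential r' (c * r') c (addReward x a y) ∂(F a)
      ≤ potential r (c * r) c x := by
  have hrr : r' ≤ r := by nlinarith
  have hgap : (r ^ 2 - r' ^ 2) / r ^ 2 = k / (4 * r ^ 2) := by rw [hkr, div_div]
  set gain : A → ℝ := fun a => 4 * c * (penalty (-(x a) / (c * r)) - penalty (-(x a) / (c * r')))
    with hgain
  have hgain0 : ∀ a, 0 ≤ gain a := fun a => by
    have := penalty_le_rescale (u := -(x a) / (c * r')) (l := r' / r) (by positivity)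
      ((div_le_one hr).2 hrr)
    rw [show r' / r * (-(x a) / (c * r')) = -(x a) / (c * r) by field_simp] at this
    exact mul_nonneg (by positivity) (sub_nonneg.2 this)
  have htot : potential r (c * r) c x = potential r (c * r') c x + ∑ a, gain a := by
    simp only [hgain, ← Finset.mul_sum, Finset.sum_sub_distrib]
    unfold potential
    ring
  -- A bound for the growth of the barrier through time: none if the sum is 0, and none once the
  -- barrier has reached 1. Positive actions gain `2 * b1`, and their total weight is at least 1/2.
  set b1 : ℝ := if 0 < posSum x ∧ posSum x < r then k / (4 * r ^ 2) else 0 with hb1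
  have hb10 : 0 ≤ b1 := by rw [hb1]; split_ifs <;> positivity
  have htime : potential r' (c * r') c x ≤ potential r (c * r') c x + b1 := by
    have : barrier (posSum x / r') ≤ barrier (posSum x / r) + b1 := by
      rcases (posSum_nonneg x).eq_or_lt with h0 | h0
      · simp only [← h0, zero_div]; linarith
      rcases lt_or_ge (posSum x) r with h | h
      · have := barrier_div_le hr' hrr h0.le
        rw [hgap] at this
        rw [hb1, if_pos ⟨h0, h⟩]
        linarith
      · rw [barrier_of_one_le ((one_le_div hr).2 h)]
        linarith [barrier_le_one (posSum x / r')]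
    unfold potential
    linarith
  have hterm : ∀ a, w a * ∫ y, potential r' (c * r') c (addReward x a y) ∂(F a)
      ≤ w a * (potential r (c * r') c x + b1)
        - 2 * b1 * (if 0 < x a then w a else 0) + gain a := by
    intro a
    rcases hlaw a with ⟨h0, hd⟩ | ⟨hne, hmom⟩
    · rw [hd, integral_dirac, addReward_zero, if_neg (by linarith)]
      have := mul_le_mul_of_nonneg_left htime (hw0 a)
      linarith [hgain0 a]
    rcases lt_or_gt_of_ne hne with hxa | hxa
    · rw [if_neg (by linarith)]
      have h1 := integral_potential_le_of_neg hmom hxa hr' hc rfl hbig'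
      have h2 := mul_penalty_le (t := -(x a)) (hw0 a) (hneg a hxa) hm hk hc hr' hr2 hkr hr he
      have h3 := mul_le_mul_of_nonneg_left (h1.trans (add_le_add_left htime _)) (hw0 a)
      have h4 := mul_le_mul_of_nonneg_left h2 (by positivity : 0 ≤ 4 * c)
      simp only [hgain]
      linarith
    · rw [if_pos hxa]
      have hz : 0 < posSum x := hxa.trans_le (le_posSum x a)
      rcases lt_or_ge (posSum x) r with h | h
      · have h1 := integral_potential_le_of_pos hmom hM hxa hr' hrr hr2 hc hc1 hbig h.le
        have hb : b1 = k / (4 * r ^ 2) := by rw [hb1, if_pos ⟨hz, h⟩]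
        rw [hgap, ← hb, show k / (2 * r ^ 2) = 2 * b1 by rw [hb]; field_simp; norm_num] at h1
        have := mul_le_mul_of_nonneg_left h1 (hw0 a)
        linarith [hgain0 a]
      · have hb : b1 = 0 := by rw [hb1, if_neg (fun h' => h.not_gt h'.2)]
        have h1 : ∀ y, potential r' (c * r') c (addReward x a y) ≤ potential r (c * r') c x := by
          intro y
          rw [potential_addReward, penalty_of_nonpos (u := -(x a) / (c * r'))
            (div_nonpos_of_nonpos_of_nonneg (by linarith) (by positivity))]
          unfold potential
          rw [barrier_of_one_le (q := posSum x / r) ((one_le_div hr).2 h)]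
          have := penalty_le (-(x a + y) / (c * r'))
          have := barrier_le_one ((posSum x - max (x a) 0 + max (x a + y) 0) / r')
          nlinarith
        have h2 := integral_mono (integrable_potential (s := c * r') hr'.le hc.le x a (F a))
          (integrable_const (potential r (c * r') c x)) h1
        simp only [integral_const, probReal_univ, one_smul] at h2
        have := mul_le_mul_of_nonneg_left h2 (hw0 a)
        rw [hb]
        linarith [hgain0 a]
  refine (Finset.sum_le_sum fun a _ => hterm a).trans ?_
  rw [Finset.sum_add_distrib, Finset.sum_sub_distrib, ← Finset.sum_mul, ← Finset.mul_sum, hw1, htot]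
  have : b1 ≤ 2 * b1 * ∑ a, (if 0 < x a then w a else 0) := by
    by_cases h : ∃ b, 0 < x b
    · obtain ⟨b, hb⟩ := h
      nlinarith [hpos b hb]
    · push Not at h
      have hb : b1 = 0 := by rw [hb1, if_neg (fun h' => h'.1.ne' (posSum_eq_zero h))]
      rw [hb]; simp
  linarith

/-! ### The shifted sum for the last stretch -/

variable {A : Type*} [Fintype A]

/-- The sum of the positive total rewards, each increased by `B`. -/
noncomputable def shiftSum (B : ℝ) (x : A → ℝ) : ℝ := ∑ b, if 0 < x b then x b + B else 0

theorem shiftSum_nonneg {B : ℝ} (hB : 0 ≤ B) (x : A → ℝ) : 0 ≤ shiftSum B x :=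
  Finset.sum_nonneg fun b _ => by split_ifs <;> linarith

theorem le_shiftSum {B : ℝ} (hB : 0 ≤ B) {x : A → ℝ} {a : A} (ha : 0 < x a) :
    x a + B ≤ shiftSum B x := by
  have := Finset.single_le_sum (f := fun b => if 0 < x b then x b + B else 0)
    (fun b _ => by split_ifs <;> linarith) (Finset.mem_univ a)
  simpa [ha, shiftSum] using this

theorem shiftSum_le {B : ℝ} (hB : 0 ≤ B) (x : A → ℝ) :
    shiftSum B x ≤ posSum x + Fintype.card A * B := by
  have : shiftSum B x ≤ ∑ b, (max (x b) 0 + B) := by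
    refine Finset.sum_le_sum fun b _ => ?_
    split_ifs with h
    · linarith [le_max_left (x b) 0]
    · linarith [le_max_right (x b) 0]
  simpa [Finset.sum_add_distrib, posSum] using this

theorem measurable_shiftSum (B : ℝ) : Measurable (shiftSum B : (A → ℝ) → ℝ) := by
  unfold shiftSum
  refine Finset.measurable_sum _ fun b _ => Measurable.ite ?_ (by fun_prop) measurable_const
  exact measurableSet_lt measurable_const (measurable_pi_apply b)

theorem abs_barrier_shiftSum_le {B r : ℝ} (hB : 0 ≤ B) (hr : 0 ≤ r) (x : A → ℝ) :
    |barrier (shiftSum B x / r)| ≤ 1 := by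
  rw [abs_of_nonneg (barrier_nonneg (div_nonneg (shiftSum_nonneg hB x) hr))]
  exact barrier_le_one _

theorem integrable_barrier_shiftSum {B r : ℝ} (hB : 0 ≤ B) (hr : 0 ≤ r) (x : A → ℝ) (a : A)
    (ν : Measure ℝ) [IsProbabilityMeasure ν] :
    Integrable (fun y => barrier (shiftSum B (addReward x a y) / r)) ν :=
  Integrable.of_bound
    ((measurable_barrier.comp ((measurable_shiftSum B).div_const r)).comp
      (measurable_addReward x a)).aestronglyMeasurable 1
    (Eventually.of_forall fun _ => abs_barrier_shiftSum_le hB hr _)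

/-- Of the two fourth-moment errors, one uses up half of the curvature gain; the other remains as `2
* M / B ^ 4`, which is summable over the last stretch. -/
theorem integral_barrier_shiftSum_le_of_pos {k m M r r' B : ℝ} {x : A → ℝ} {a : A}
    {ν : Measure ℝ} [IsProbabilityMeasure ν] (h : MomentBounds k m M ν) (hM : 0 ≤ M)
    (hxa : 0 < x a) (hr' : 0 < r') (hrr : r' ≤ r) (hB : 0 < B) (hBr : B ≤ r)
    (hbig : 2 * M ≤ k * B ^ 2) (hz : shiftSum B x ≤ r) :
    ∫ y, barrier (shiftSum B (addReward x a y) / r') ∂ν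
      ≤ barrier (shiftSum B x / r) + (r ^ 2 - r' ^ 2) / r ^ 2 - k / (2 * r ^ 2)
        + 2 * M / B ^ 4 := by
  have hr : 0 < r := by linarith
  have hxz := le_shiftSum hB.le hxa
  have key : ∀ y, barrier (shiftSum B (addReward x a y) / r')
      ≤ (barrier (shiftSum B x / r) + (r ^ 2 - r' ^ 2) / r ^ 2)
        + (2 * (1 - shiftSum B x / r) / r) * y - (1 / r ^ 2) * (min y 0) ^ 2
        + (1 / (r ^ 2 * B ^ 2) + 2 / (r * B ^ 3)) * y ^ 4 := by
    intro y
    have h1 := barrier_shift_le (q := shiftSum B x / r) (p := x a / r) (x := y / r) (d := B / r)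
      (by positivity) (by rw [← add_div]; gcongr) ((div_le_one hr).2 hz) (by positivity) rfl
    have hm : min (y / r) 0 = min y 0 / r := by
      rw [← min_div_div_right hr.le, zero_div]
    have hnew : shiftSum B x / r - (x a / r + B / r)
          + (if 0 < x a / r + y / r then x a / r + y / r + B / r else 0)
        = shiftSum B (addReward x a y) / r := by
      unfold shiftSum
      rw [sum_addReward (fun t => if 0 < t then t + B else 0) x a y, if_pos hxa,
        show x a / r + y / r = (x a + y) / r by ring]
      have : 0 < (x a + y) / r ↔ 0 < x a + y := by
        rw [div_pos_iff_of_pos_right hr]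
      simp only [this]
      split_ifs <;> ring
    rw [hm, hnew] at h1
    have h2 := barrier_div_le hr' hrr (shiftSum_nonneg hB.le (addReward x a y))
    have e1 : (y / r) ^ 4 / (B / r) ^ 2 + 2 * (y / r) ^ 4 / (B / r) ^ 3
        = (1 / (r ^ 2 * B ^ 2) + 2 / (r * B ^ 3)) * y ^ 4 := by
      field_simp
    have e2 : (min y 0 / r) ^ 2 = (1 / r ^ 2) * (min y 0) ^ 2 := by rw [div_pow]; ring
    have e3 : 2 * (1 - shiftSum B x / r) * (y / r) = (2 * (1 - shiftSum B x / r) / r) * y := by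
      ring
    linarith
  have hq1 : shiftSum B x / r ≤ 1 := (div_le_one hr).2 hz
  have := h.integral_le_quartic (integrable_barrier_shiftSum hB.le hr'.le x a ν)
    (div_nonneg (by linarith) hr.le) (by positivity) (by positivity) key
  refine this.trans ?_
  have h1 : 1 / (r ^ 2 * B ^ 2) * M ≤ k / (2 * r ^ 2) := by
    rw [div_mul_eq_mul_div, div_le_div_iff₀ (by positivity) (by positivity)]
    nlinarith [mul_le_mul_of_nonneg_right hbig (by positivity : 0 ≤ r ^ 2)]
  have h2 : 2 / (r * B ^ 3) * M ≤ 2 * M / B ^ 4 := by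
    rw [div_mul_eq_mul_div]
    apply div_le_div_of_nonneg_left (by positivity) (by positivity)
    calc B ^ 4 = B * B ^ 3 := by ring
      _ ≤ r * B ^ 3 := by gcongr
  have : k / (2 * r ^ 2) = 1 / r ^ 2 * k - k / (2 * r ^ 2) := by field_simp; ring
  linarith

/-- The expected barrier of the shifted sum increases little in a round of greedy play with rare
exploration. -/
theorem sum_integral_barrier_shiftSum_le {k m M r r' B e : ℝ} {x : A → ℝ} {F : A → Measure ℝ}
    [∀ a, IsProbabilityMeasure (F a)] {w : A → ℝ} (hk : 0 < k) (hM : 0 ≤ M)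
    (hlaw : ∀ a, (x a = 0 ∧ F a = Measure.dirac 0) ∨ (x a ≠ 0 ∧ MomentBounds k m M (F a)))
    (hw0 : ∀ a, 0 ≤ w a) (hw1 : ∑ a, w a = 1) (he : 0 ≤ e) (hneg : ∀ a, x a < 0 → w a ≤ e)
    (hpos : ∀ b, 0 < x b → 1 / 2 ≤ ∑ a, if 0 < x a then w a else 0)
    (hr' : 0 < r') (hr : 0 < r) (hkr : r ^ 2 - r' ^ 2 = k / 4) (hB : 0 < B) (hBr : B ≤ r)
    (hbig : 2 * M ≤ k * B ^ 2) :
    ∑ a, w a * ∫ y, barrier (shiftSum B (addReward x a y) / r') ∂(F a)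
      ≤ barrier (shiftSum B x / r) + Fintype.card A * e + 2 * M / B ^ 4 := by
  have hrr : r' ≤ r := by nlinarith
  have hgap : (r ^ 2 - r' ^ 2) / r ^ 2 = k / (4 * r ^ 2) := by rw [hkr, div_div]
  have herr : 0 ≤ 2 * M / B ^ 4 := by positivity
  have hS := shiftSum_nonneg hB.le x
  set b1 : ℝ := if 0 < shiftSum B x ∧ shiftSum B x < r then k / (4 * r ^ 2) else 0 with hb1
  have hb10 : 0 ≤ b1 := by rw [hb1]; split_ifs <;> positivity
  have hterm : ∀ a, w a * ∫ y, barrier (shiftSum B (addReward x a y) / r') ∂(F a)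
      ≤ w a * (barrier (shiftSum B x / r) + b1 + 2 * M / B ^ 4)
        - 2 * b1 * (if 0 < x a then w a else 0) + e := by
    intro a
    have hint := integrable_barrier_shiftSum (x := x) (a := a) (ν := F a) hB.le hr'.le
    rcases hlaw a with ⟨h0, hd⟩ | ⟨hne, hmom⟩
    · rw [hd, integral_dirac, addReward_zero, if_neg (by linarith)]
      have htime : barrier (shiftSum B x / r') ≤ barrier (shiftSum B x / r) + b1 := by
        rcases hS.eq_or_lt with h0 | h0
        · simp only [← h0, zero_div]; linarith
        rcases lt_or_ge (shiftSum B x) r with h | h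
        · have := barrier_div_le hr' hrr h0.le
          rw [hgap] at this
          rw [hb1, if_pos ⟨h0, h⟩]
          linarith
        · rw [barrier_of_one_le ((one_le_div hr).2 h)]
          linarith [barrier_le_one (shiftSum B x / r')]
      have := mul_le_mul_of_nonneg_left
        (htime.trans (b := _) (c := barrier (shiftSum B x / r) + b1 + 2 * M / B ^ 4)
          (by linarith)) (hw0 a)
      linarith
    have hone : ∫ y, barrier (shiftSum B (addReward x a y) / r') ∂(F a) ≤ 1 := by
      have h2 := integral_mono hint (integrable_const (1 : ℝ)) (fun y => barrier_le_one _)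
      simpa using h2
    -- A negative action gets only the trivial bound 1, at weight at most `e`: a return above 0
    -- would also gain the shift `B`.
    rcases lt_or_gt_of_ne hne with hxa | hxa
    · rw [if_neg (by linarith)]
      have h1 := mul_le_mul_of_nonneg_left hone (hw0 a)
      have h2 := hneg a hxa
      have h3 : 0 ≤ barrier (shiftSum B x / r) := barrier_nonneg (by positivity)
      have h4 : 0 ≤ w a * (barrier (shiftSum B x / r) + b1 + 2 * M / B ^ 4) :=
        mul_nonneg (hw0 a) (by positivity)
      linarith
    · rw [if_pos hxa]
      have hz : 0 < shiftSum B x := by linarith [le_shiftSum hB.le hxa]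
      rcases lt_or_ge (shiftSum B x) r with h | h
      · have h1 := integral_barrier_shiftSum_le_of_pos hmom hM hxa hr' hrr hB hBr hbig h.le
        have hb : b1 = k / (4 * r ^ 2) := by rw [hb1, if_pos ⟨hz, h⟩]
        rw [hgap, ← hb, show k / (2 * r ^ 2) = 2 * b1 by rw [hb]; field_simp; norm_num] at h1
        have := mul_le_mul_of_nonneg_left h1 (hw0 a)
        linarith
      · have hb : b1 = 0 := by rw [hb1, if_neg (fun h' => h.not_gt h'.2)]
        rw [barrier_of_one_le ((one_le_div hr).2 h), hb]
        have h1 := mul_le_mul_of_nonneg_left hone (hw0 a)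
        have := mul_nonneg (hw0 a) herr
        linarith
  refine (Finset.sum_le_sum fun a _ => hterm a).trans ?_
  rw [Finset.sum_add_distrib, Finset.sum_sub_distrib, ← Finset.sum_mul, ← Finset.mul_sum, hw1]
  simp only [Finset.sum_const, Finset.card_univ, nsmul_eq_mul]
  have : b1 ≤ 2 * b1 * ∑ a, (if 0 < x a then w a else 0) := by
    by_cases h : ∃ b, 0 < x b
    · obtain ⟨b, hb⟩ := h
      nlinarith [hpos b hb]
    · push Not at h
      have hS0 : shiftSum B x = 0 :=
        Finset.sum_eq_zero fun b _ => if_neg (not_lt.2 (h b))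
      have hb : b1 = 0 := by rw [hb1, if_neg (fun h' => h'.1.ne' hS0)]
      rw [hb]; simp
  linarith

/-! ### Conditioning on the history -/

section Dynamics

variable {A : Type*} {Ω : Type*} [Fintype A]

theorem Strategy.nonneg (π : Strategy A) (t : ℕ) (h : Fin t → A × ℝ) (a : A) :
    0 ≤ (π t h).1 a := (π t h).2.1 a

theorem Strategy.le_one (π : Strategy A) (t : ℕ) (h : Fin t → A × ℝ) (a : A) :
    (π t h).1 a ≤ 1 := by
  rw [← (π t h).2.2]
  exact Finset.single_le_sum (f := (π t h).1) (fun b _ => (π t h).2.1 b) (Finset.mem_univ a)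

variable [MeasurableSpace A] [MeasurableSpace Ω] {π : Strategy A} {F : A → Measure ℝ}
  {P : Measure Ω} {act : ℕ → Ω → A} {rew : ℕ → Ω → ℝ}

theorem IsBanditProcess.measurable_hist (h : IsBanditProcess π F P act rew) (t : ℕ) :
    Measurable (hist act rew t) :=
  measurable_pi_lambda _ fun i => (h.measurable_act i).prodMk (h.measurable_rew i)

theorem IsBanditProcess.aestronglyMeasurable_strategy (h : IsBanditProcess π F P act rew)
    (t : ℕ) (a : A) : AEStronglyMeasurable (fun ω => (π t (hist act rew t ω)).1 a) P :=
  (stronglyMeasurable_condExp.mono (h.measurable_hist t).comap_le).aestronglyMeasurable.congr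
    (h.act_law t a)

variable [IsProbabilityMeasure P]

theorem IsBanditProcess.integrable_strategy_mul (h : IsBanditProcess π F P act rew) (t : ℕ)
    (a : A) {G : (Fin t → A × ℝ) → ℝ} (hG : Measurable G) {C : ℝ} (hC : ∀ x, |G x| ≤ C) :
    Integrable (fun ω => (π t (hist act rew t ω)).1 a * G (hist act rew t ω)) P := by
  refine Integrable.of_bound ((h.aestronglyMeasurable_strategy t a).mul
    (hG.comp (h.measurable_hist t)).aestronglyMeasurable) C (Eventually.of_forall fun ω => ?_)
  rw [norm_mul, Real.norm_eq_abs, Real.norm_eq_abs, abs_of_nonneg (π.nonneg _ _ _)]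
  nlinarith [hC (hist act rew t ω), abs_nonneg (G (hist act rew t ω)),
    π.le_one t (hist act rew t ω) a, π.nonneg t (hist act rew t ω) a]

variable [MeasurableSingletonClass A]

theorem IsBanditProcess.integral_act (h : IsBanditProcess π F P act rew) (t : ℕ) (a : A)
    {G : (Fin t → A × ℝ) → ℝ} (hG : Measurable G) {C : ℝ} (hC : ∀ x, |G x| ≤ C) :
    ∫ ω, (act t ⁻¹' {a}).indicator (fun _ => (1 : ℝ)) ω * G (hist act rew t ω) ∂P
      = ∫ ω, (π t (hist act rew t ω)).1 a * G (hist act rew t ω) ∂P := by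
  have hm := (h.measurable_hist t).comap_le
  have hS : MeasurableSet (act t ⁻¹' {a}) := h.measurable_act t (measurableSet_singleton a)
  have hf : Integrable ((act t ⁻¹' {a}).indicator fun _ => (1 : ℝ)) P :=
    (integrable_const (1 : ℝ)).indicator hS
  have hGm : StronglyMeasurable[MeasurableSpace.comap (hist act rew t) inferInstance]
      (fun ω => G (hist act rew t ω)) :=
    (hG.comp (comap_measurable (hist act rew t))).stronglyMeasurable
  have hfg : Integrable (((act t ⁻¹' {a}).indicator fun _ => (1 : ℝ))
      * fun ω => G (hist act rew t ω)) P :=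
    hf.mul_bdd (hGm.mono hm).aestronglyMeasurable (Eventually.of_forall fun ω => hC _)
  have h1 := condExp_mul_of_stronglyMeasurable_right hGm hfg hf
  have h2 := integral_condExp (μ := P) hm (f := ((act t ⁻¹' {a}).indicator fun _ => (1 : ℝ))
      * fun ω => G (hist act rew t ω))
  change ∫ ω, (((act t ⁻¹' {a}).indicator fun _ => (1 : ℝ)) * fun ω => G (hist act rew t ω)) ω ∂P
    = _
  rw [← h2]
  refine integral_congr_ae ?_
  filter_upwards [h1, h.act_law t a] with ω h1 h2
  rw [h1, Pi.mul_apply, h2]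

variable [∀ a, IsProbabilityMeasure (F a)]

/-- The reward distribution as a kernel on the histories with the next action. -/
noncomputable def rewardKernel (F : A → Measure ℝ) (t : ℕ) :
    Kernel ((Fin t → A × ℝ) × A) ℝ :=
  (⟨F, measurable_of_countable F⟩ : Kernel A ℝ).comap Prod.snd measurable_snd

theorem rewardKernel_apply (F : A → Measure ℝ) (t : ℕ) (p : (Fin t → A × ℝ) × A) :
    rewardKernel F t p = F p.2 := rfl

instance (t : ℕ) : IsMarkovKernel (rewardKernel F t) :=
  ⟨fun p => by rw [rewardKernel_apply]; infer_instance⟩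

/-- The conditional law of the reward, given one set `B` at a time, determines the joint law on
rectangles, hence everywhere. -/
theorem IsBanditProcess.map_eq_compProd (h : IsBanditProcess π F P act rew) (t : ℕ) :
    P.map (fun ω => ((hist act rew t ω, act t ω), rew t ω))
      = (P.map (fun ω => (hist act rew t ω, act t ω))) ⊗ₘ rewardKernel F t := by
  have hX : Measurable (fun ω => (hist act rew t ω, act t ω)) :=
    (h.measurable_hist t).prodMk (h.measurable_act t)
  have hR := h.measurable_rew t
  have : IsProbabilityMeasure (P.map (fun ω => (hist act rew t ω, act t ω))) :=
    Measure.isProbabilityMeasure_map hX.aemeasurable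
  refine Measure.ext_prod fun {S B} hS hB => ?_
  rw [Measure.map_apply (hX.prodMk hR) (hS.prod hB), Measure.compProd_apply_prod hS hB,
    setLIntegral_map hS (Kernel.measurable_coe _ hB) hX]
  simp only [rewardKernel_apply]
  have hm := hX.comap_le
  have hB' : MeasurableSet (rew t ⁻¹' B) := hR hB
  have h1 := setIntegral_condExp (μ := P) (f := (rew t ⁻¹' B).indicator fun _ => (1 : ℝ)) hm
    ((integrable_const (1 : ℝ)).indicator hB') (s := (fun ω => (hist act rew t ω, act t ω)) ⁻¹' S)
    ⟨S, hS, rfl⟩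
  rw [setIntegral_congr_ae (g := fun ω => (F (act t ω)).real B) (hX hS)
    ((h.rew_law t B hB).mono fun ω hω _ => hω), setIntegral_indicator hB'] at h1
  simp only [integral_const, measureReal_restrict_apply_univ, smul_eq_mul, mul_one] at h1
  have hmeas : Measurable fun ω => F (act t ω) B :=
    (measurable_of_countable fun a => F a B).comp (h.measurable_act t)
  have h2 : ∫⁻ ω in (fun ω => (hist act rew t ω, act t ω)) ⁻¹' S, F (act t ω) B ∂P
      = ENNReal.ofReal (∫ ω in (fun ω => (hist act rew t ω, act t ω)) ⁻¹' S,
          (F (act t ω)).real B ∂P) := by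
    simp only [Measure.real]
    rw [integral_toReal hmeas.aemeasurable (Eventually.of_forall fun ω => measure_lt_top _ _),
      ENNReal.ofReal_toReal]
    refine ((setLIntegral_mono measurable_const fun ω _ => prob_le_one).trans_lt ?_).ne
    · simp
  rw [h2, h1, ofReal_measureReal]
  rfl

/-- The expectation of a function of the history up to and including round `t`, by conditioning
on the history before round `t`. -/
theorem IsBanditProcess.integral_step (h : IsBanditProcess π F P act rew) (t : ℕ)
    {g : ((Fin t → A × ℝ) × A) × ℝ → ℝ} (hg : Measurable g) {C : ℝ} (hC : ∀ p, |g p| ≤ C) :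
    ∫ ω, g ((hist act rew t ω, act t ω), rew t ω) ∂P
      = ∫ ω, ∑ a, (π t (hist act rew t ω)).1 a * ∫ x, g ((hist act rew t ω, a), x) ∂(F a) ∂P := by
  have hX : Measurable (fun ω => (hist act rew t ω, act t ω)) :=
    (h.measurable_hist t).prodMk (h.measurable_act t)
  have hR := h.measurable_rew t
  have : IsProbabilityMeasure (P.map (fun ω => (hist act rew t ω, act t ω))) :=
    Measure.isProbabilityMeasure_map hX.aemeasurable
  set G : (Fin t → A × ℝ) × A → ℝ := fun p => ∫ x, g (p, x) ∂(rewardKernel F t p) with hGdef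
  have hG : Measurable G := (hg.stronglyMeasurable.integral_kernel_prod_right').measurable
  have hGC : ∀ p, |G p| ≤ C := fun p => by
    have := norm_integral_le_of_norm_le_const (μ := rewardKernel F t p)
      (Eventually.of_forall fun x => (Real.norm_eq_abs _).trans_le (hC (p, x)))
    simpa using this
  have hGa : ∀ a, Measurable fun x => G (x, a) := fun a => hG.comp (by fun_prop)
  calc ∫ ω, g ((hist act rew t ω, act t ω), rew t ω) ∂P
      = ∫ p, g p ∂(P.map (fun ω => ((hist act rew t ω, act t ω), rew t ω))) :=
        (integral_map (hX.prodMk hR).aemeasurable hg.aestronglyMeasurable).symm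
    _ = ∫ p, G p ∂(P.map (fun ω => (hist act rew t ω, act t ω))) := by
        rw [h.map_eq_compProd t, Measure.integral_compProd
          (Integrable.of_bound hg.aestronglyMeasurable C (Eventually.of_forall hC))]
    _ = ∫ ω, G (hist act rew t ω, act t ω) ∂P := integral_map hX.aemeasurable
        hG.aestronglyMeasurable
    _ = ∫ ω, ∑ a, (act t ⁻¹' {a}).indicator (fun _ => (1 : ℝ)) ω * G (hist act rew t ω, a) ∂P := by
        congr 1; funext ω
        classical
        rw [Finset.sum_eq_single (act t ω)]
        · simp
        · intro b _ hb
          simp [Ne.symm hb]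
        · simp
    _ = ∑ a, ∫ ω, (π t (hist act rew t ω)).1 a * G (hist act rew t ω, a) ∂P := by
        rw [integral_finsetSum]
        · exact Finset.sum_congr rfl fun a _ => h.integral_act t a (hGa a) fun x => hGC _
        · intro a _
          exact ((integrable_const (1 : ℝ)).indicator
            (h.measurable_act t (measurableSet_singleton a))).mul_bdd
            ((hGa a).comp (h.measurable_hist t)).aestronglyMeasurable
            (Eventually.of_forall fun ω => hGC _)
    _ = _ := by
        rw [← integral_finsetSum]
        · rfl
        · exact fun a _ => h.integrable_strategy_mul t a (hGa a) fun x => hGC _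

theorem IsBanditProcess.integral_step_le (h : IsBanditProcess π F P act rew) (t : ℕ)
    {g : ((Fin t → A × ℝ) × A) × ℝ → ℝ} (hg : Measurable g) {C : ℝ} (hC : ∀ p, |g p| ≤ C)
    {U : Ω → ℝ} (hU : Integrable U P)
    (hle : ∀ᵐ ω ∂P,
      ∑ a, (π t (hist act rew t ω)).1 a * ∫ x, g ((hist act rew t ω, a), x) ∂(F a) ≤ U ω) :
    ∫ ω, g ((hist act rew t ω, act t ω), rew t ω) ∂P ≤ ∫ ω, U ω ∂P := by
  rw [h.integral_step t hg hC]
  refine integral_mono_ae (integrable_finsetSum _ fun a _ => ?_) hU hle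
  have hG : Measurable fun p : (Fin t → A × ℝ) × A => ∫ x, g (p, x) ∂(rewardKernel F t p) :=
    (hg.stronglyMeasurable.integral_kernel_prod_right').measurable
  refine h.integrable_strategy_mul (G := fun y => ∫ x, g ((y, a), x) ∂(F a)) t a
    (hG.comp (by fun_prop : Measurable fun y : Fin t → A × ℝ => (y, a))) (C := C) fun x => ?_
  have := norm_integral_le_of_norm_le_const (μ := F a) 
    (Eventually.of_forall fun y => (Real.norm_eq_abs _).trans_le (hC ((x, a), y)))
  simpa using this

end Dynamics

/-! ### Bounds on the choice probabilities -/

section GreedyProb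

variable {A : Type*} [Fintype A]

theorem div_card_le_greedyProb {e : ℝ} (he1 : e ≤ 1) (f : A → ℝ) (a : A) :
    e * (1 / (Fintype.card A : ℝ)) ≤ greedyProb e f a := by
  classical
  unfold greedyProb
  have : 0 ≤ (1 - e) * (if a ∈ argmax f then 1 / ((argmax f).card : ℝ) else 0) :=
    mul_nonneg (by linarith) (by split_ifs <;> positivity)
  refine le_add_of_nonneg_left (this.trans_eq ?_)
  congr

theorem greedyProb_le_of_lt {e : ℝ} (he : 0 ≤ e) {f : A → ℝ} {a b : A} (h : f a < f b) :
    greedyProb e f a ≤ e := by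
  have ha : a ∉ argmax f := fun hmem => by
    simp only [argmax, Finset.mem_filter, Finset.mem_univ, true_and] at hmem
    exact (hmem b).not_gt h
  have : Nonempty A := ⟨a⟩
  have hc : (1 : ℝ) ≤ Fintype.card A := by exact_mod_cast Fintype.card_pos
  rw [greedyProb, if_neg ha, mul_zero, zero_add]
  exact mul_le_of_le_one_right he ((div_le_one (by linarith)).2 hc)

theorem sub_le_sum_greedyProb [Nonempty A] {e : ℝ} (he : 0 ≤ e) (f : A → ℝ)
    (p : A → Prop) [DecidablePred p] (hp : ∀ a ∈ argmax f, p a) :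
    1 - e ≤ ∑ a, if p a then greedyProb e f a else 0 := by
  classical
  have hc : ((argmax f).card : ℝ) ≠ 0 := by
    exact_mod_cast (Finset.card_pos.2 (argmax_nonempty f)).ne'
  have h1 : ∑ a, (1 - e) * (if a ∈ argmax f then 1 / ((argmax f).card : ℝ) else 0) = 1 - e := by
    simp only [← Finset.mul_sum, Finset.sum_ite_mem, Finset.univ_inter, Finset.sum_const,
      nsmul_eq_mul]
    field_simp
  refine h1.symm.trans_le (Finset.sum_le_sum fun a _ => ?_)
  have hc0 : 0 ≤ e * (1 / (Fintype.card A : ℝ)) := by positivity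
  by_cases ha : a ∈ argmax f
  · rw [if_pos (hp a ha), greedyProb]
    linarith
  · rw [if_neg ha, mul_zero]
    split_ifs
    · rw [greedyProb, if_neg ha]; linarith
    · exact le_rfl

end GreedyProb

/-! ### Total rewards and the exploration event -/

section Totals

variable {A : Type*}

open Classical in
/-- The vector of the total rewards of the actions in the history `h`. -/
noncomputable def totals {t : ℕ} (h : Fin t → A × ℝ) (b : A) : ℝ :=
  ∑ i, if (h i).1 = b then (h i).2 else 0

theorem avgReward_eq {t : ℕ} (h : Fin t → A × ℝ) (b : A) :
    avgReward h b = if count h b = 0 then 0 else totals h b / count h b := by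
  unfold avgReward totals
  rw [Finset.sum_filter]

theorem count_ne_zero {t : ℕ} {h : Fin t → A × ℝ} {b : A} (hb : ∃ i, (h i).1 = b) :
    count h b ≠ 0 := by
  classical
  obtain ⟨i, hi⟩ := hb
  unfold count
  exact (Finset.card_pos.2 ⟨i, by simp [hi]⟩).ne'

theorem avgReward_pos_iff {t : ℕ} {h : Fin t → A × ℝ} {b : A} (hb : ∃ i, (h i).1 = b) :
    0 < avgReward h b ↔ 0 < totals h b := by
  have hc := count_ne_zero hb
  have hc' : (0 : ℝ) < count h b := by exact_mod_cast Nat.pos_of_ne_zero hc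
  rw [avgReward_eq, if_neg hc, div_pos_iff_of_pos_right hc']

theorem avgReward_neg_iff {t : ℕ} {h : Fin t → A × ℝ} {b : A} (hb : ∃ i, (h i).1 = b) :
    avgReward h b < 0 ↔ totals h b < 0 := by
  have hc := count_ne_zero hb
  have hc' : (0 : ℝ) < count h b := by exact_mod_cast Nat.pos_of_ne_zero hc
  rw [avgReward_eq, if_neg hc, div_lt_iff₀ hc', zero_mul]

theorem avgReward_eq_zero {t : ℕ} {h : Fin t → A × ℝ} {b : A} (hb : totals h b = 0) :
    avgReward h b = 0 := by
  rw [avgReward_eq, hb, zero_div, ite_self]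

theorem totals_hist_succ {Ω : Type*} (act : ℕ → Ω → A) (rew : ℕ → Ω → ℝ) (t : ℕ) (ω : Ω) :
    totals (hist act rew (t + 1) ω)
      = addReward (totals (hist act rew t ω)) (act t ω) (rew t ω) := by
  funext b
  simp only [totals, addReward, hist, Fin.sum_univ_castSucc, Fin.val_castSucc, Fin.val_last]
  congr 1
  by_cases hb : b = act t ω
  · simp [hb]
  · simp [hb, Ne.symm hb]

theorem totals_hist_zero {Ω : Type*} (act : ℕ → Ω → A) (rew : ℕ → Ω → ℝ) (ω : Ω) (b : A) :
    totals (hist act rew 0 ω) b = 0 := by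
  simp [totals]

theorem measurable_totals [MeasurableSpace A] [MeasurableSingletonClass A] (t : ℕ) :
    Measurable (totals : (Fin t → A × ℝ) → A → ℝ) := by
  classical
  refine measurable_pi_lambda _ fun b => ?_
  unfold totals
  refine Finset.measurable_sum _ fun i _ => Measurable.ite ?_ (by fun_prop) measurable_const
  exact (measurable_fst.comp (measurable_pi_apply i)) (measurableSet_singleton b)

/-- All actions have been chosen before round `s`. -/
def Explored (s : ℕ) {t : ℕ} (h : Fin t → A × ℝ) : Prop :=
  ∀ b, ∃ i : Fin t, (i : ℕ) < s ∧ (h i).1 = b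

theorem explored_hist_iff {Ω : Type*} (act : ℕ → Ω → A) (rew : ℕ → Ω → ℝ) {s t : ℕ} (hst : s ≤ t)
    (ω : Ω) : Explored s (hist act rew t ω) ↔ ∀ b, ∃ i < s, act i ω = b := by
  refine forall_congr' fun b => ⟨?_, ?_⟩
  · rintro ⟨i, hi, h⟩
    exact ⟨i, hi, h⟩
  · rintro ⟨i, hi, h⟩
    exact ⟨⟨i, hi.trans_le hst⟩, hi, h⟩

theorem measurableSet_explored [Finite A] [MeasurableSpace A] [MeasurableSingletonClass A]
    (s t : ℕ) : MeasurableSet {h : Fin t → A × ℝ | Explored s h} := by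
  simp only [Explored, Set.ofPred_forall, Set.ofPred_exists]
  refine MeasurableSet.iInter fun b => MeasurableSet.iUnion fun i => ?_
  exact (MeasurableSet.const _).inter
    ((measurable_fst.comp (measurable_pi_apply i)) (measurableSet_singleton b))

end Totals

/-! ### Almost sure signs of the totals -/

section Dynamics

variable {A : Type*} {Ω : Type*} [Fintype A] [MeasurableSpace A] [MeasurableSingletonClass A]
  [MeasurableSpace Ω] {π : Strategy A} {F : A → Measure ℝ} [∀ a, IsProbabilityMeasure (F a)]
  {P : Measure Ω} [IsProbabilityMeasure P] {act : ℕ → Ω → A} {rew : ℕ → Ω → ℝ}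

theorem IsBanditProcess.ae_notMem (h : IsBanditProcess π F P act rew) (t : ℕ)
    {D : Set (((Fin t → A × ℝ) × A) × ℝ)} (hD : MeasurableSet D)
    (h0 : ∀ p, F p.2 {x | (p, x) ∈ D} = 0) :
    ∀ᵐ ω ∂P, ((hist act rew t ω, act t ω), rew t ω) ∉ D := by
  have hX : Measurable (fun ω => (hist act rew t ω, act t ω)) :=
    (h.measurable_hist t).prodMk (h.measurable_act t)
  have : IsProbabilityMeasure (P.map (fun ω => (hist act rew t ω, act t ω))) :=
    Measure.isProbabilityMeasure_map hX.aemeasurable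
  have h1 : P.map (fun ω => ((hist act rew t ω, act t ω), rew t ω)) D = 0 := by
    rw [h.map_eq_compProd t, Measure.compProd_apply hD]
    refine (lintegral_congr fun p => ?_).trans lintegral_zero
    exact h0 p
  rw [Measure.map_apply (hX.prodMk (h.measurable_rew t)) hD] at h1
  exact measure_eq_zero_iff_ae_notMem.1 h1

theorem IsBanditProcess.ae_totals_eq_zero (h : IsBanditProcess π F P act rew) {a₀ : A}
    (hdet : F a₀ = Measure.dirac 0) :
    ∀ᵐ ω ∂P, ∀ t, totals (hist act rew t ω) a₀ = 0 := by
  have h1 : ∀ᵐ ω ∂P, ∀ t, ¬ (act t ω = a₀ ∧ rew t ω ≠ 0) := by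
    refine ae_all_iff.2 fun t => ?_
    refine h.ae_notMem t (D := {p | p.1.2 = a₀ ∧ p.2 ≠ 0}) ?_ fun p => ?_
    · exact ((by fun_prop : Measurable fun p : ((Fin t → A × ℝ) × A) × ℝ => p.1.2)
        (measurableSet_singleton a₀)).inter (measurable_snd (measurableSet_singleton 0).compl)
    · by_cases hp : p.2 = a₀
      · simp [hp, hdet]
      · simp [hp]
  filter_upwards [h1] with ω hω t
  induction t with
  | zero => exact totals_hist_zero act rew ω a₀
  | succ t ih =>
    rw [totals_hist_succ, addReward, ih, zero_add]
    split_ifs with hb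
    · by_contra hne
      exact hω t ⟨hb.symm, hne⟩
    · rfl

/-- A total returns to 0 only if the latest reward equals minus the previous total, a single point
and hence a null set for an atomless law. -/
theorem IsBanditProcess.ae_totals_ne_zero (h : IsBanditProcess π F P act rew) {a₀ : A}
    (hcont : ∀ a, a ≠ a₀ → IsContinuousDist (F a)) :
    ∀ᵐ ω ∂P, ∀ t b, b ≠ a₀ → (∃ i < t, act i ω = b) → totals (hist act rew t ω) b ≠ 0 := by
  have h1 : ∀ᵐ ω ∂P, ∀ t, ¬ (act t ω ≠ a₀ ∧ totals (hist act rew t ω) (act t ω) + rew t ω = 0) := by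
    refine ae_all_iff.2 fun t => ?_
    refine h.ae_notMem t (D := {p | p.1.2 ≠ a₀ ∧ totals p.1.1 p.1.2 + p.2 = 0}) ?_ fun p => ?_
    · have hm : Measurable fun p : (Fin t → A × ℝ) × A => totals p.1 p.2 :=
        measurable_from_prod_countable_left fun a =>
          (measurable_pi_apply a).comp (measurable_totals t)
      refine ((by fun_prop : Measurable fun p : ((Fin t → A × ℝ) × A) × ℝ => p.1.2)
        (measurableSet_singleton a₀).compl).inter ?_
      exact ((hm.comp measurable_fst).add measurable_snd) (measurableSet_singleton 0)
    · by_cases hp : p.2 = a₀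
      · simp [hp]
      · refine measure_mono_null (fun x hx => ?_) (hcont _ hp (-totals p.1 p.2))
        simp only [Set.mem_ofPred_eq] at hx
        rw [Set.mem_singleton_iff]
        linarith [hx.2]
  filter_upwards [h1] with ω hω t
  induction t with
  | zero => rintro b - ⟨i, hi, -⟩; exact absurd hi (Nat.not_lt_zero i)
  | succ t ih =>
    rintro b hb ⟨i, hi, hib⟩
    rw [totals_hist_succ, addReward]
    split_ifs with hbt
    · intro h0
      exact hω t ⟨hbt ▸ hb, hbt ▸ h0⟩
    · rw [add_zero]
      refine ih b hb ⟨i, (Nat.lt_succ_iff_lt_or_eq.1 hi).resolve_right ?_, hib⟩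
      rintro rfl
      exact hbt hib.symm

end Dynamics

/-! ### Every action is eventually tried -/

section Exploration

variable {A : Type*} {Ω : Type*} [Fintype A] [Nonempty A] [MeasurableSpace A]
  [MeasurableSingletonClass A] [MeasurableSpace Ω] {ε : ℕ → unitInterval} {F : A → Measure ℝ}
  [∀ a, IsProbabilityMeasure (F a)] {P : Measure Ω} [IsProbabilityMeasure P]
  {act : ℕ → Ω → A} {rew : ℕ → Ω → ℝ}

theorem IsBanditProcess.measureReal_not_chosen_succ_le
    (h : IsBanditProcess (epsGreedy ε) F P act rew) (b : A) (t : ℕ) :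
    P.real {ω | ∀ i < t + 1, act i ω ≠ b}
      ≤ (1 - (ε t : ℝ) / Fintype.card A) * P.real {ω | ∀ i < t, act i ω ≠ b} := by
  classical
  set S : Set (Fin t → A × ℝ) := {x | ∀ i, (x i).1 ≠ b} with hS
  have hSm : MeasurableSet S := by
    simp only [hS, Set.ofPred_forall]
    exact MeasurableSet.iInter fun i =>
      (measurable_fst.comp (measurable_pi_apply i)) (measurableSet_singleton b).compl
  have hmem : ∀ ω, hist act rew t ω ∈ S ↔ ∀ i < t, act i ω ≠ b := fun ω =>
    ⟨fun hω i hi => hω ⟨i, hi⟩, fun hω i => hω i i.2⟩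
  have hev : MeasurableSet {ω | ∀ i < t, act i ω ≠ b} := by
    have := h.measurable_hist t hSm
    rwa [show hist act rew t ⁻¹' S = {ω | ∀ i < t, act i ω ≠ b} from Set.ext hmem] at this
  set D : Set (((Fin t → A × ℝ) × A) × ℝ) := {p | p.1.1 ∈ S ∧ p.1.2 ≠ b} with hD
  have hDm : MeasurableSet D :=
    ((measurable_fst.comp measurable_fst) hSm).inter
      ((measurable_snd.comp measurable_fst) (measurableSet_singleton b).compl)
  have hev' : {ω | ∀ i < t + 1, act i ω ≠ b}
      = {ω | ((hist act rew t ω, act t ω), rew t ω) ∈ D} := by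
    ext ω
    simp only [hD, Set.mem_ofPred_eq, hmem]
    exact Nat.forall_lt_succ_right
  have hevm : MeasurableSet {ω | ∀ i < t + 1, act i ω ≠ b} := by
    rw [hev']
    exact (((h.measurable_hist t).prodMk (h.measurable_act t)).prodMk (h.measurable_rew t)) hDm
  have key := h.integral_step_le t (g := D.indicator fun _ => (1 : ℝ))
    (measurable_const.indicator hDm) (C := 1)
    (fun p => by by_cases hp : p ∈ D <;> simp [hp])
    (U := fun ω => (1 - (ε t : ℝ) / Fintype.card A)
      * {ω | ∀ i < t, act i ω ≠ b}.indicator (fun _ => (1 : ℝ)) ω)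
    (((integrable_const (1 : ℝ)).indicator hev).const_mul _) (Eventually.of_forall fun ω => ?_)
  · rw [integral_const_mul, integral_indicator_const _ hev, smul_eq_mul, mul_one] at key
    refine le_trans (le_of_eq ?_) key
    rw [hev', ← mul_one (P.real _), ← smul_eq_mul, ← integral_indicator_const _ (hev' ▸ hevm)]
    rfl
  · by_cases hω : ∀ i < t, act i ω ≠ b
    · rw [Set.indicator_of_mem (by exact hω), mul_one]
      have hterm : ∀ a, ∫ x, D.indicator (fun _ => (1 : ℝ)) ((hist act rew t ω, a), x) ∂(F a)
          = if a = b then 0 else 1 := by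
        intro a
        by_cases hab : a = b
        · simp [hD, hab]
        · simp [hD, hab, (hmem ω).2 hω]
      simp only [hterm]
      have hsum := (epsGreedy ε t (hist act rew t ω)).2.2
      rw [← Finset.add_sum_erase _ _ (Finset.mem_univ b)] at hsum ⊢
      have he : ∑ a ∈ Finset.univ.erase b, (epsGreedy ε t (hist act rew t ω)).1 a
            * (if a = b then (0 : ℝ) else 1)
          = ∑ a ∈ Finset.univ.erase b, (epsGreedy ε t (hist act rew t ω)).1 a :=
        Finset.sum_congr rfl fun a ha => by simp [Finset.ne_of_mem_erase ha]
      rw [he, if_pos rfl, mul_zero, zero_add]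
      have := div_card_le_greedyProb (ε t).2.2 (avgReward (hist act rew t ω)) b
      rw [mul_one_div] at this
      change _ ≤ (epsGreedy ε t (hist act rew t ω)).1 b at this
      linarith
    · rw [Set.indicator_of_notMem (by exact hω), mul_zero]
      refine (Finset.sum_eq_zero fun a _ => ?_).le
      have : hist act rew t ω ∉ S := fun hh => hω ((hmem ω).1 hh)
      simp [hD, this]

/-- The factors `1 - ε t / card A` are at most exponentials, whose product tends to 0 by divergence
of the sum of the rates. -/
theorem IsBanditProcess.tendsto_not_chosen (h : IsBanditProcess (epsGreedy ε) F P act rew)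
    (hεsum : Tendsto (fun n => ∑ t ∈ Finset.range n, (ε t : ℝ)) atTop atTop) (b : A) :
    Tendsto (fun t => P.real {ω | ∀ i < t, act i ω ≠ b}) atTop (𝓝 0) := by
  have hcard : (0 : ℝ) < Fintype.card A := by exact_mod_cast Fintype.card_pos
  have hle : ∀ t, P.real {ω | ∀ i < t, act i ω ≠ b}
      ≤ Real.exp (-((∑ i ∈ Finset.range t, (ε i : ℝ)) / Fintype.card A)) := by
    intro t
    induction t with
    | zero => simp
    | succ t ih =>
      refine (h.measureReal_not_chosen_succ_le b t).trans ?_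
      rw [Finset.sum_range_succ, add_div, neg_add, Real.exp_add, mul_comm]
      refine mul_le_mul ih ?_ ?_ (Real.exp_nonneg _)
      · linarith [Real.add_one_le_exp (-((ε t : ℝ) / Fintype.card A))]
      · rw [sub_nonneg, div_le_one hcard]
        have : (1 : ℝ) ≤ Fintype.card A := by exact_mod_cast Fintype.card_pos
        exact (ε t).2.2.trans this
  refine squeeze_zero (fun _ => measureReal_nonneg) hle ?_
  exact Real.tendsto_exp_neg_atTop_nhds_zero.comp (hεsum.atTop_div_const hcard)

theorem IsBanditProcess.tendsto_not_explored (h : IsBanditProcess (epsGreedy ε) F P act rew)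
    (hεsum : Tendsto (fun n => ∑ t ∈ Finset.range n, (ε t : ℝ)) atTop atTop) :
    Tendsto (fun t => P.real {ω | ∀ b, ∃ i < t, act i ω = b}ᶜ) atTop (𝓝 0) := by
  have h1 := tendsto_finsetSum (Finset.univ : Finset A) fun b _ => h.tendsto_not_chosen hεsum b
  rw [Finset.sum_const_zero] at h1
  refine squeeze_zero (fun _ => measureReal_nonneg) (fun t => ?_) h1
  have : {ω | ∀ b, ∃ i < t, act i ω = b}ᶜ = ⋃ b, {ω | ∀ i < t, act i ω ≠ b} := by
    ext ω; simp
  rw [this]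
  exact measureReal_iUnion_fintype_le _

end Exploration

/-! ### Moments of the reward distributions -/

section Moments

theorem IsSubGaussian.memLp_id {ν : Measure ℝ} [IsProbabilityMeasure ν] (h : IsSubGaussian ν)
    (p : NNReal) : MemLp (fun x : ℝ => x) p ν := by
  obtain ⟨c, hc⟩ := h
  have := (hc.memLp p).add (memLp_const (∫ y, y ∂ν))
  refine this.congr_norm (by fun_prop) (Eventually.of_forall fun x => ?_)
  simp

theorem IsSubGaussian.integrable_pow {ν : Measure ℝ} [IsProbabilityMeasure ν]
    (h : IsSubGaussian ν) {n : ℕ} (hn : n ≠ 0) (heven : Even n) :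
    Integrable (fun x : ℝ => x ^ n) ν := by
  have h1 := (h.memLp_id n).integrable_norm_pow (by exact_mod_cast hn)
  refine h1.congr (Eventually.of_forall fun x => ?_)
  simp [heven.pow_abs]

theorem IsSubGaussian.integrable_id {ν : Measure ℝ} [IsProbabilityMeasure ν]
    (h : IsSubGaussian ν) : Integrable (fun x : ℝ => x) ν :=
  memLp_one_iff_integrable.1 (by exact_mod_cast h.memLp_id 1)

/-- A law without negative part and with mean at most 0 is concentrated at 0, which would be an
atom. -/
theorem IsContinuousDist.integral_lower_sq_pos {ν : Measure ℝ} [IsProbabilityMeasure ν]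
    (hcont : IsContinuousDist ν) (hint : Integrable (fun x : ℝ => x) ν)
    (hsq : Integrable (fun x : ℝ => (min x 0) ^ 2) ν) (hmean : ∫ x, x ∂ν ≤ 0) :
    0 < ∫ x, (min x 0) ^ 2 ∂ν := by
  refine (integral_nonneg fun x => by positivity).lt_of_ne fun h0 => ?_
  have h1 := (integral_eq_zero_iff_of_nonneg (fun x => by positivity) hsq).1 h0.symm
  have hnn : 0 ≤ᵐ[ν] fun x : ℝ => x := by
    filter_upwards [h1] with x hx
    have : min x 0 = 0 := by simpa using hx
    simpa using this
  have h2 := (integral_eq_zero_iff_of_nonneg_ae hnn hint).1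
    (le_antisymm hmean (integral_nonneg_of_ae hnn))
  have h3 : ν {(0 : ℝ)}ᶜ = 0 := by
    refine measure_mono_null (fun x hx => ?_) (ae_iff.1 h2)
    simpa using hx
  rw [prob_compl_eq_zero_iff (measurableSet_singleton _), hcont 0] at h3
  exact zero_ne_one h3

theorem exists_momentBounds {A : Type*} [Fintype A] [Nonempty A] {F : A → Measure ℝ}
    [∀ a, IsProbabilityMeasure (F a)] (hsub : ∀ a, IsSubGaussian (F a)) {a₀ : A}
    (hmean : ∀ a, a ≠ a₀ → ∫ x, x ∂(F a) ≤ 0)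
    (hcont : ∀ a, a ≠ a₀ → IsContinuousDist (F a)) :
    ∃ k m M : ℝ, 0 < k ∧ 0 ≤ m ∧ 0 ≤ M ∧ ∀ a, a ≠ a₀ → MomentBounds k m M (F a) := by
  classical
  have hsq : ∀ a, Integrable (fun x : ℝ => x ^ 2) (F a) := fun a =>
    (hsub a).integrable_pow two_ne_zero even_two
  have hlow : ∀ a, Integrable (fun x : ℝ => (min x 0) ^ 2) (F a) := fun a => by
    refine (hsq a).mono' (by fun_prop) (Eventually.of_forall fun x => ?_)
    rw [Real.norm_of_nonneg (by positivity)]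
    exact min_zero_sq_le x
  -- The safe action has no negative part; the value 1 keeps the minimum positive.
  obtain ⟨a₁, ha₁⟩ := Finite.exists_min fun a =>
    if a = a₀ then (1 : ℝ) else ∫ x, (min x 0) ^ 2 ∂(F a)
  refine ⟨if a₁ = a₀ then (1 : ℝ) else ∫ x, (min x 0) ^ 2 ∂(F a₁), ∑ a, ∫ x, x ^ 2 ∂(F a),
    ∑ a, ∫ x, x ^ 4 ∂(F a), ?_, ?_, ?_, fun a ha => ⟨(hsub a).integrable_id, hsq a,
      (hsub a).integrable_pow four_ne_zero (by decide), hmean a ha, ?_, ?_, ?_⟩⟩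
  · split_ifs with h
    · exact one_pos
    · exact (hcont a₁ h).integral_lower_sq_pos (hsub a₁).integrable_id (hlow a₁) (hmean a₁ h)
  · exact Finset.sum_nonneg fun a _ => integral_nonneg fun x => by positivity
  · exact Finset.sum_nonneg fun a _ => integral_nonneg fun x => by positivity
  · simpa [ha] using ha₁ a
  · exact Finset.single_le_sum (f := fun a => ∫ x, x ^ 2 ∂(F a))
      (fun a _ => integral_nonneg fun x => by positivity) (Finset.mem_univ a)
  · exact Finset.single_le_sum (f := fun a => ∫ x, x ^ 4 ∂(F a))
      (fun a _ => integral_nonneg fun x => by positivity) (Finset.mem_univ a)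

end Moments

/-! ### One greedy round in expectation -/

section Round

variable {A : Type*} [Fintype A]

open Classical in
/-- The conditions on the total rewards `x` and the choice probabilities `w` in a round of greedy
play with exploration rate at most `e`. -/
structure GreedyRound (F : A → Measure ℝ) (k m M e : ℝ) (x w : A → ℝ) : Prop where
  law : ∀ a, (x a = 0 ∧ F a = Measure.dirac 0) ∨ (x a ≠ 0 ∧ MomentBounds k m M (F a))
  nonneg : ∀ a, 0 ≤ w a
  sum_eq_one : ∑ a, w a = 1
  le_of_neg : ∀ a, x a < 0 → w a ≤ e
  half_le_of_pos : ∀ b, 0 < x b → 1 / 2 ≤ ∑ a, if 0 < x a then w a else 0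

variable {Ω : Type*} [Nonempty A] [MeasurableSpace A] [MeasurableSingletonClass A]
  [MeasurableSpace Ω] {ε : ℕ → unitInterval} {F : A → Measure ℝ}
  [∀ a, IsProbabilityMeasure (F a)] {P : Measure Ω} [IsProbabilityMeasure P]
  {act : ℕ → Ω → A} {rew : ℕ → Ω → ℝ} {k m M e : ℝ} {a₀ : A}

/-- After exploration, averages and totals have the same sign. The safe average 0 keeps negative
actions out of the maximizers, and if some average is positive then all maximizers are, with weight
at least `1 - e ≥ 1/2`. -/
theorem IsBanditProcess.ae_greedyRound (h : IsBanditProcess (epsGreedy ε) F P act rew)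
    (hdet : F a₀ = Measure.dirac 0) (hcont : ∀ a, a ≠ a₀ → IsContinuousDist (F a))
    (hmom : ∀ a, a ≠ a₀ → MomentBounds k m M (F a)) {s₀ : ℕ} (he : e ≤ 1 / 2)
    (hεe : ∀ s, s₀ ≤ s → (ε s : ℝ) ≤ e) :
    ∀ᵐ ω ∂P, ∀ s, s₀ ≤ s → Explored s₀ (hist act rew s ω) →
      GreedyRound F k m M e (totals (hist act rew s ω))
        ((epsGreedy ε s (hist act rew s ω)).1) := by
  classical
  filter_upwards [h.ae_totals_eq_zero hdet, h.ae_totals_ne_zero hcont] with ω hz hnz s hs hex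
  have hch : ∀ b, ∃ i, (hist act rew s ω i).1 = b := fun b => (hex b).imp fun _ h => h.2
  have hex' := (explored_hist_iff act rew hs ω).1 hex
  refine ⟨fun a => ?_, (epsGreedy ε s _).2.1, (epsGreedy ε s _).2.2, fun a ha => ?_,
    fun b hb => ?_⟩
  · by_cases ha : a = a₀
    · exact Or.inl ⟨ha ▸ hz s, ha ▸ hdet⟩
    · obtain ⟨i, hi, hia⟩ := hex' a
      exact Or.inr ⟨hnz s a ha ⟨i, hi.trans_le hs, hia⟩, hmom a ha⟩
  · refine (greedyProb_le_of_lt (b := a₀) (ε s).2.1 ?_).trans (hεe s hs)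
    rw [avgReward_eq_zero (hz s)]
    exact (avgReward_neg_iff (hch a)).2 ha
  · have h1 := sub_le_sum_greedyProb (ε s).2.1 (avgReward (hist act rew s ω))
      (fun a => 0 < totals (hist act rew s ω) a) fun a ha => by
        simp only [argmax, Finset.mem_filter, Finset.mem_univ, true_and] at ha
        exact (avgReward_pos_iff (hch a)).1
          (((avgReward_pos_iff (hch b)).2 hb).trans_le (ha b))
    have h2 := hεe s hs
    refine le_trans ?_ (h1.trans_eq ?_)
    · linarith
    · exact Finset.sum_congr rfl fun a _ => by congr

/-- A one-step bound for all greedy rounds gives a bound for the expectations. -/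
theorem IsBanditProcess.integral_indicator_succ_le
    (h : IsBanditProcess (epsGreedy ε) F P act rew)
    (hdet : F a₀ = Measure.dirac 0) (hcont : ∀ a, a ≠ a₀ → IsContinuousDist (F a))
    (hmom : ∀ a, a ≠ a₀ → MomentBounds k m M (F a)) {s₀ s : ℕ} (he : e ≤ 1 / 2)
    (hεe : ∀ s, s₀ ≤ s → (ε s : ℝ) ≤ e) (hs : s₀ ≤ s) {H H' : (A → ℝ) → ℝ} (hH : Measurable H)
    (hH' : Measurable H') {C δ : ℝ} (hC : ∀ x, |H x| ≤ C) (hC' : ∀ x, |H' x| ≤ C) (hδ : 0 ≤ δ)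
    (hround : ∀ x w, GreedyRound F k m M e x w →
      ∑ a, w a * ∫ y, H' (addReward x a y) ∂(F a) ≤ H x + δ) :
    ∫ ω, {ω | ∀ b, ∃ i < s₀, act i ω = b}.indicator
        (fun ω => H' (totals (hist act rew (s + 1) ω))) ω ∂P
      ≤ ∫ ω, {ω | ∀ b, ∃ i < s₀, act i ω = b}.indicator
        (fun ω => H (totals (hist act rew s ω))) ω ∂P + δ := by
  classical
  have hE : {ω | ∀ b, ∃ i < s₀, act i ω = b}
      = hist act rew s ⁻¹' {x | Explored s₀ x} :=
    Set.ext fun ω => (explored_hist_iff act rew hs ω).symm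
  have hEm : MeasurableSet {ω | ∀ b, ∃ i < s₀, act i ω = b} := by
    rw [hE]; exact h.measurable_hist s (measurableSet_explored s₀ s)
  have hD : MeasurableSet {p : ((Fin s → A × ℝ) × A) × ℝ | Explored s₀ p.1.1} :=
    (measurable_fst.comp measurable_fst) (measurableSet_explored s₀ s)
  have hadd : Measurable fun p : ((Fin s → A × ℝ) × A) × ℝ =>
      addReward (totals p.1.1) p.1.2 p.2 := by
    refine measurable_pi_lambda _ fun b => ?_
    refine (((measurable_pi_apply b).comp (measurable_totals s)).comp
      (measurable_fst.comp measurable_fst)).add (Measurable.ite ?_ measurable_snd measurable_const)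
    have : MeasurableSet {a : A | b = a} := (Set.toFinite _).measurableSet
    exact (measurable_snd.comp measurable_fst) this
  have hC0 : 0 ≤ C := (abs_nonneg _).trans (hC 0)
  have hint : Integrable ({ω | ∀ b, ∃ i < s₀, act i ω = b}.indicator
      (fun ω => H (totals (hist act rew s ω)))) P := by
    refine Integrable.indicator (Integrable.of_bound (hH.comp ((measurable_totals s).comp
      (h.measurable_hist s))).aestronglyMeasurable C (Eventually.of_forall fun ω => hC _)) hEm
  have key := h.integral_step_le s
    (g := {p : ((Fin s → A × ℝ) × A) × ℝ | Explored s₀ p.1.1}.indicator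
      fun p => H' (addReward (totals p.1.1) p.1.2 p.2))
    ((hH'.comp hadd).indicator hD) (C := C) (fun p => by
      by_cases hp : p ∈ {p : ((Fin s → A × ℝ) × A) × ℝ | Explored s₀ p.1.1}
      · rw [Set.indicator_of_mem hp]; exact hC' _
      · rw [Set.indicator_of_notMem hp, abs_zero]; exact hC0)
    (U := fun ω => {ω | ∀ b, ∃ i < s₀, act i ω = b}.indicator
        (fun ω => H (totals (hist act rew s ω))) ω + δ) (hint.add (integrable_const δ)) ?_
  · rw [integral_add hint (integrable_const δ)] at key
    simp only [integral_const, probReal_univ, one_smul] at key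
    refine le_trans (le_of_eq ?_) key
    refine integral_congr_ae (Eventually.of_forall fun ω => ?_)
    simp only [Set.indicator_apply, Set.mem_ofPred_eq, totals_hist_succ,
      explored_hist_iff act rew hs ω]
  · filter_upwards [h.ae_greedyRound hdet hcont hmom he hεe] with ω hω
    by_cases hex : Explored s₀ (hist act rew s ω)
    · have hmem : ω ∈ {ω | ∀ b, ∃ i < s₀, act i ω = b} := (explored_hist_iff act rew hs ω).1 hex
      rw [Set.indicator_of_mem hmem]
      refine le_trans (le_of_eq ?_) (hround _ _ (hω s hs hex))
      refine Finset.sum_congr rfl fun a _ => ?_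
      simp [hex]
    · have hmem : ω ∉ {ω | ∀ b, ∃ i < s₀, act i ω = b} :=
        fun hh => hex ((explored_hist_iff act rew hs ω).2 hh)
      rw [Set.indicator_of_notMem hmem, zero_add]
      refine le_trans (le_of_eq (Finset.sum_eq_zero fun a _ => ?_)) hδ
      simp [hex]

/-- The probability that the deterministic action is chosen is almost the probability that no
action has a positive total reward. -/
theorem IsBanditProcess.mul_measureReal_le (h : IsBanditProcess (epsGreedy ε) F P act rew)
    (hdet : F a₀ = Measure.dirac 0) (hcont : ∀ a, a ≠ a₀ → IsContinuousDist (F a)) {s₀ t : ℕ}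
    (hst : s₀ ≤ t) :
    (1 - (ε t : ℝ)) * P.real ({ω | ∀ b, ∃ i < s₀, act i ω = b}
        ∩ {ω | ∀ b, totals (hist act rew t ω) b ≤ 0})
      ≤ P.real {ω | act t ω = a₀} := by
  classical
  set E := {ω | ∀ b, ∃ i < s₀, act i ω = b} ∩ {ω | ∀ b, totals (hist act rew t ω) b ≤ 0} with hEdef
  have hE : E = hist act rew t ⁻¹' ({x | Explored s₀ x} ∩ {x | ∀ b, totals x b ≤ 0}) := by
    rw [Set.preimage_inter, hEdef]
    congr 1
    exact Set.ext fun ω => (explored_hist_iff act rew hst ω).symm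
  have hEm : MeasurableSet E := by
    rw [hE]
    refine h.measurable_hist t ((measurableSet_explored s₀ t).inter ?_)
    simp only [Set.ofPred_forall]
    exact MeasurableSet.iInter fun b => measurableSet_le
      ((measurable_pi_apply b).comp (measurable_totals t)) measurable_const
  have h1 := h.integral_act t a₀ (G := fun _ => (1 : ℝ)) measurable_const (C := 1) (by simp)
  have hS : MeasurableSet (act t ⁻¹' {a₀}) := h.measurable_act t (measurableSet_singleton a₀)
  simp only [mul_one] at h1
  rw [integral_indicator_const _ hS, smul_eq_mul, mul_one] at h1
  have h2 : P.real {ω | act t ω = a₀} = P.real (act t ⁻¹' {a₀}) := rfl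
  rw [h2, h1, mul_comm, ← smul_eq_mul, ← integral_indicator_const _ hEm]
  have hint := h.integrable_strategy_mul t a₀ (G := fun _ => (1 : ℝ)) measurable_const (C := 1)
    (by simp)
  simp only [mul_one] at hint
  refine integral_mono_ae ((integrable_const _).indicator hEm) hint ?_
  filter_upwards [h.ae_totals_eq_zero hdet, h.ae_totals_ne_zero hcont] with ω hz hnz
  by_cases hω : ω ∈ E
  · rw [Set.indicator_of_mem hω]
    obtain ⟨hex, hneg⟩ := hω
    have hex' := (explored_hist_iff act rew hst ω).2 hex
    have hch : ∀ b, ∃ i, (hist act rew t ω i).1 = b := fun b => (hex' b).imp fun _ h => h.2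
    have h3 := sub_le_sum_greedyProb (ε t).2.1 (avgReward (hist act rew t ω))
      (fun a => a = a₀) fun a ha => by
        by_contra hne
        simp only [argmax, Finset.mem_filter, Finset.mem_univ, true_and] at ha
        obtain ⟨i, hi, hia⟩ := hex a
        have hlt := (hneg a).lt_of_ne (hnz t a hne ⟨i, hi.trans_le hst, hia⟩)
        have := ha a₀
        rw [avgReward_eq_zero (hz t)] at this
        exact absurd ((avgReward_neg_iff (hch a)).2 hlt) this.not_gt
    rw [Finset.sum_ite_eq' Finset.univ a₀, if_pos (Finset.mem_univ _)] at h3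
    exact h3
  · rw [Set.indicator_of_notMem hω]
    exact Strategy.nonneg _ _ _ _

end Round

/-! ### The time scale -/

/-- The scale at which total rewards matter when `n` rounds remain. -/
noncomputable def scale (k : ℝ) (n : ℕ) : ℝ := √(k * n / 4)

theorem scale_sq {k : ℝ} (hk : 0 ≤ k) (n : ℕ) : scale k n ^ 2 = k * n / 4 :=
  Real.sq_sqrt (by positivity)

theorem scale_pos {k : ℝ} (hk : 0 < k) {n : ℕ} (hn : 1 ≤ n) : 0 < scale k n := by
  have : (0 : ℝ) < n := by exact_mod_cast hn
  exact Real.sqrt_pos.2 (by positivity)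

theorem scale_nonneg (k : ℝ) (n : ℕ) : 0 ≤ scale k n := Real.sqrt_nonneg _

theorem scale_mono {k : ℝ} (hk : 0 ≤ k) : Monotone (scale k) := fun a b hab => by
  unfold scale; gcongr

theorem scale_succ_le {k : ℝ} (hk : 0 < k) {n : ℕ} (hn : 1 ≤ n) :
    scale k (n + 1) ≤ 2 * scale k n := by
  refine le_of_sq_le_sq ?_ (mul_nonneg two_pos.le (scale_nonneg k n))
  rw [mul_pow, scale_sq hk.le, scale_sq hk.le]
  have : (1 : ℝ) ≤ n := by exact_mod_cast hn
  push_cast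
  nlinarith

theorem scale_succ_sq_sub {k : ℝ} (hk : 0 ≤ k) (n : ℕ) :
    scale k (n + 1) ^ 2 - scale k n ^ 2 = k / 4 := by
  rw [scale_sq hk, scale_sq hk]
  push_cast
  ring

theorem tendsto_scale {k : ℝ} (hk : 0 < k) : Tendsto (scale k) atTop atTop := by
  refine Real.tendsto_sqrt_atTop.comp ?_
  exact (tendsto_natCast_atTop_atTop.const_mul_atTop hk).atTop_div_const (by norm_num)

/-! ### From one round to the whole horizon -/

section

variable {A : Type*} [Fintype A] {Ω : Type*} [Nonempty A] [MeasurableSpace A]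
  [MeasurableSingletonClass A] [MeasurableSpace Ω] {ε : ℕ → unitInterval} {F : A → Measure ℝ}
  {P : Measure Ω} [IsProbabilityMeasure P] {act : ℕ → Ω → A} {rew : ℕ → Ω → ℝ}
  {k m M e : ℝ} {a₀ : A}

theorem IsBanditProcess.tendsto_integral_barrier (h : IsBanditProcess (epsGreedy ε) F P act rew)
    (hk : 0 < k) (s : ℕ) :
    Tendsto (fun n => ∫ ω, barrier (posSum (totals (hist act rew s ω)) / scale k n) ∂P) atTop
      (𝓝 0) := by
  have hmeas : ∀ n, Measurable fun ω => barrier (posSum (totals (hist act rew s ω)) / scale k n) :=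
    fun n => measurable_barrier.comp ((measurable_posSum.comp
      ((measurable_totals s).comp (h.measurable_hist s))).div_const _)
  have hcts : Continuous barrier := by unfold barrier; fun_prop
  have := tendsto_integral_of_dominated_convergence (μ := P) (fun _ => (1 : ℝ))
    (f := fun _ => (0 : ℝ)) (fun n => (hmeas n).aestronglyMeasurable) (integrable_const 1)
    (fun n => Eventually.of_forall fun ω => by
      rw [Real.norm_of_nonneg (barrier_nonneg (div_nonneg (posSum_nonneg _) (scale_nonneg _ _)))]
      exact barrier_le_one _)
    (Eventually.of_forall fun ω => by
      have h1 : Tendsto (fun n => posSum (totals (hist act rew s ω)) / scale k n) atTop (𝓝 0) :=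
        (tendsto_scale hk).const_div_atTop _
      have h2 := (hcts.tendsto 0).comp h1
      rwa [barrier_zero] at h2)
  simpa using this

variable [∀ a, IsProbabilityMeasure (F a)]

/-- At least `T` rounds remain before the deadline, which keeps the scale large enough for the
one-round estimate; `416 = 4 * 104`, as the squared scale is `k * n / 4`. -/
theorem IsBanditProcess.integral_potential_le (h : IsBanditProcess (epsGreedy ε) F P act rew)
    (hdet : F a₀ = Measure.dirac 0) (hcont : ∀ a, a ≠ a₀ → IsContinuousDist (F a))
    (hmom : ∀ a, a ≠ a₀ → MomentBounds k m M (F a)) {s₀ : ℕ} (he : e ≤ 1 / 2)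
    (hεe : ∀ s, s₀ ≤ s → (ε s : ℝ) ≤ e) (hk : 0 < k) (hm : 0 ≤ m) (hM : 0 ≤ M) {c : ℝ}
    (hc : 0 < c) (hc1 : c ≤ 1) (hec : 6144 * e * m ≤ k * c ^ 2) {T : ℕ} (hT : 1 ≤ T)
    (hbig : 416 * M ≤ k ^ 2 * c ^ 3 * T) {D : ℕ} (j : ℕ) (hj : s₀ + j + T ≤ D) :
    ∫ ω, {ω | ∀ b, ∃ i < s₀, act i ω = b}.indicator
        (fun ω => potential (scale k (D - (s₀ + j))) (c * scale k (D - (s₀ + j))) c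
          (totals (hist act rew (s₀ + j) ω))) ω ∂P
      ≤ ∫ ω, {ω | ∀ b, ∃ i < s₀, act i ω = b}.indicator
        (fun ω => potential (scale k (D - s₀)) (c * scale k (D - s₀)) c
          (totals (hist act rew s₀ ω))) ω ∂P := by
  induction j with
  | zero => exact le_rfl
  | succ j ih =>
    refine le_trans ?_ (ih (by omega))
    obtain ⟨τ, hτ⟩ : ∃ τ, D - (s₀ + (j + 1)) = τ := ⟨_, rfl⟩
    have hτ' : D - (s₀ + j) = τ + 1 := by omega
    have hTτ : T ≤ τ := by omega
    rw [hτ, hτ', ← add_assoc]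
    have hr' := scale_pos hk (hT.trans hTτ)
    have hr := scale_pos hk (by omega : 1 ≤ τ + 1)
    have hTr : (T : ℝ) ≤ τ := by exact_mod_cast hTτ
    have hk2 : k ^ 2 * c ^ 3 * T ≤ k ^ 2 * c ^ 3 * τ := by gcongr
    have step := h.integral_indicator_succ_le hdet hcont hmom he hεe (s₀ := s₀) (s := s₀ + j)
      (by omega) (H := potential (scale k (τ + 1)) (c * scale k (τ + 1)) c)
      (H' := potential (scale k τ) (c * scale k τ) c) (measurable_potential _ _ _)
      (measurable_potential _ _ _) (C := 1 + 20 * c * Fintype.card A) (δ := 0)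
      (fun x => abs_potential_le hr.le hc.le x) (fun x => abs_potential_le hr'.le hc.le x) le_rfl
      (fun x w hw => by
        rw [add_zero]
        refine sum_integral_potential_le (k := k) (m := m) (M := M) (e := e) hk hm hM hw.law
          hw.nonneg hw.sum_eq_one hw.le_of_neg ?_ hr' (scale_succ_le hk (hT.trans hTτ))
          (scale_succ_sq_sub hk.le τ) hr hc hc1 hec ?_ ?_
        · intro b hb
          refine (hw.half_le_of_pos b hb).trans_eq (Finset.sum_congr rfl fun a _ => by congr)
        · rw [scale_sq hk.le]
          push_cast
          have : 0 ≤ k ^ 2 * c ^ 3 := by positivity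
          nlinarith
        · rw [mul_pow, scale_sq hk.le]
          have h23 : c ^ 3 ≤ c ^ 2 := pow_le_pow_of_le_one hc.le hc1 (by norm_num)
          have : k ^ 2 * c ^ 3 * τ ≤ k ^ 2 * c ^ 2 * τ := by gcongr
          nlinarith)
    rwa [add_zero] at step

theorem IsBanditProcess.integral_barrier_shiftSum_le
    (h : IsBanditProcess (epsGreedy ε) F P act rew)
    (hdet : F a₀ = Measure.dirac 0) (hcont : ∀ a, a ≠ a₀ → IsContinuousDist (F a))
    (hmom : ∀ a, a ≠ a₀ → MomentBounds k m M (F a)) {s₀ : ℕ} (he : e ≤ 1 / 2) (he0 : 0 ≤ e)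
    (hεe : ∀ s, s₀ ≤ s → (ε s : ℝ) ≤ e) (hk : 0 < k) (hM : 0 ≤ M) {n : ℕ} (hn : 1 ≤ n)
    (hbig : 8 * M ≤ k ^ 2 * n) {D s₁ : ℕ} (hs : s₀ ≤ s₁) (j : ℕ) (hj : s₁ + j + n ≤ D) :
    ∫ ω, {ω | ∀ b, ∃ i < s₀, act i ω = b}.indicator
        (fun ω => barrier (shiftSum (scale k n) (totals (hist act rew (s₁ + j) ω))
          / scale k (D - (s₁ + j)))) ω ∂P
      ≤ ∫ ω, {ω | ∀ b, ∃ i < s₀, act i ω = b}.indicator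
        (fun ω => barrier (shiftSum (scale k n) (totals (hist act rew s₁ ω))
          / scale k (D - s₁))) ω ∂P + j * (Fintype.card A * e + 2 * M / scale k n ^ 4) := by
  induction j with
  | zero => simp
  | succ j ih =>
    have ih := ih (by omega)
    obtain ⟨τ, hτ⟩ : ∃ τ, D - (s₁ + (j + 1)) = τ := ⟨_, rfl⟩
    have hτ' : D - (s₁ + j) = τ + 1 := by omega
    have hnτ : n ≤ τ := by omega
    rw [hτ'] at ih
    rw [hτ, ← add_assoc]
    have hr' := scale_pos hk (hn.trans hnτ)
    have hr := scale_pos hk (by omega : 1 ≤ τ + 1)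
    have hB := scale_pos hk hn
    have step := h.integral_indicator_succ_le hdet hcont hmom he hεe (s₀ := s₀) (s := s₁ + j)
      (by omega) (H := fun x => barrier (shiftSum (scale k n) x / scale k (τ + 1)))
      (H' := fun x => barrier (shiftSum (scale k n) x / scale k τ))
      (measurable_barrier.comp ((measurable_shiftSum _).div_const _))
      (measurable_barrier.comp ((measurable_shiftSum _).div_const _)) (C := 1)
      (δ := Fintype.card A * e + 2 * M / scale k n ^ 4)
      (fun x => abs_barrier_shiftSum_le hB.le hr.le x)
      (fun x => abs_barrier_shiftSum_le hB.le hr'.le x) (by positivity)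
      (fun x w hw => by
        rw [← add_assoc]
        refine sum_integral_barrier_shiftSum_le (k := k) (m := m) (M := M) (e := e) hk hM hw.law
          hw.nonneg hw.sum_eq_one he0 hw.le_of_neg ?_ hr' hr
          (scale_succ_sq_sub hk.le τ) hB (scale_mono hk.le (by omega)) ?_
        · intro b hb
          refine (hw.half_le_of_pos b hb).trans_eq (Finset.sum_congr rfl fun a _ => by congr)
        · rw [scale_sq hk.le]
          linarith)
    push_cast
    linarith

-- Order of choices: `c`, then `N`, `n` and `T = N * n`, then `e`, then `s₀`, and finally `t`.
-- Losses in units of `η`: 2 for the initial potential, 1 for introducing the shift, 2 for the last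
-- stretch, 1 for incomplete exploration before `s₀`, and 1 for exploring in round `t`.
set_option maxHeartbeats 1000000 in
theorem IsBanditProcess.eventually_le_measureReal
    (h : IsBanditProcess (epsGreedy ε) F P act rew)
    (hε : Tendsto (fun t => (ε t : ℝ)) atTop (𝓝 0))
    (hεsum : Tendsto (fun n => ∑ t ∈ Finset.range n, (ε t : ℝ)) atTop atTop)
    (hdet : F a₀ = Measure.dirac 0) (hcont : ∀ a, a ≠ a₀ → IsContinuousDist (F a))
    (hmom : ∀ a, a ≠ a₀ → MomentBounds k m M (F a)) (hk : 0 < k) (hm : 0 ≤ m) (hM : 0 ≤ M)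
    {η : ℝ} (hη : 0 < η) : ∀ᶠ t in atTop, 1 - 7 * η ≤ P.real {ω | act t ω = a₀} := by
  set K : ℝ := (Fintype.card A : ℝ) with hK
  have hK1 : 1 ≤ K := by rw [hK]; exact_mod_cast Fintype.card_pos
  obtain ⟨c, hc, hc1, hcK⟩ : ∃ c : ℝ, 0 < c ∧ c ≤ 1 ∧ 20 * c * K ≤ η := by
    refine ⟨min 1 (η / (20 * K)), lt_min one_pos (by positivity), min_le_left _ _, ?_⟩
    have := (le_div_iff₀ (by positivity)).1 (min_le_right 1 (η / (20 * K)))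
    linarith
  -- The shift adds at most `K * scale k n` to the sum, relative to `scale k T = √N * scale k n`;
  -- the barrier doubles this.
  obtain ⟨N, hN⟩ := exists_nat_gt ((2 * K / η) ^ 2)
  have hN0 : (0 : ℝ) < N := lt_of_le_of_lt (by positivity) hN
  have hN1 : 1 ≤ N := by exact_mod_cast hN0
  have hNs : 2 * K / √N ≤ η := by
    have : 2 * K / η ≤ √N := Real.le_sqrt_of_sq_le hN.le
    rw [div_le_iff₀ hη] at this
    rw [div_le_iff₀ (Real.sqrt_pos.2 hN0)]
    linarith
  have hlarge : ∀ a b : ℝ, 0 < a → ∀ᶠ n : ℕ in atTop, b ≤ a * n := fun a b ha =>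
    (tendsto_natCast_atTop_atTop.const_mul_atTop ha).eventually_ge_atTop b
  -- The last condition makes `T` times the error `2 * M / scale k n ^ 4` at most `η`.
  obtain ⟨n, hn1, hn2, hn3, hn4⟩ := ((eventually_ge_atTop 1).and
    ((hlarge (k ^ 2) (8 * M) (by positivity)).and
    ((hlarge (k ^ 2 * c ^ 3) (416 * M) (by positivity)).and
    (hlarge (η * k ^ 2) (32 * N * M) (by positivity))))).exists
  have hn0 : (0 : ℝ) < n := by exact_mod_cast hn1
  obtain ⟨T, hT⟩ : ∃ T, T = N * n := ⟨_, rfl⟩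
  have hnT : n ≤ T := hT ▸ Nat.le_mul_of_pos_left n hN1
  have hT0 : (0 : ℝ) < T := by exact_mod_cast hn1.trans hnT
  have hTc : (T : ℝ) = N * n := by rw [hT]; push_cast; rfl
  obtain ⟨e, he0, he, heη, hec, heT⟩ : ∃ e : ℝ, 0 < e ∧ e ≤ 1 / 2 ∧ e ≤ η
      ∧ 6144 * e * m ≤ k * c ^ 2 ∧ T * (K * e) ≤ η := by
    refine ⟨min (min (1 / 2) η) (min (k * c ^ 2 / (6144 * (m + 1))) (η / (T * K))),
      by positivity, (min_le_left _ _).trans (min_le_left _ _),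
      (min_le_left _ _).trans (min_le_right _ _), ?_, ?_⟩
    · set e := min (min (1 / 2) η) (min (k * c ^ 2 / (6144 * (m + 1))) (η / (T * K)))
      have h0 : 0 < e := by positivity
      have h1 : e ≤ k * c ^ 2 / (6144 * (m + 1)) := (min_le_right _ _).trans (min_le_left _ _)
      rw [le_div_iff₀ (by positivity)] at h1
      nlinarith
    · set e := min (min (1 / 2) η) (min (k * c ^ 2 / (6144 * (m + 1))) (η / (T * K)))
      have h1 : e ≤ η / (T * K) := (min_le_right _ _).trans (min_le_right _ _)
      rw [le_div_iff₀ (by positivity)] at h1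
      linarith
  obtain ⟨s₀, hεe, hex⟩ := ((eventually_forall_ge_atTop.2
    (hε.eventually (Iic_mem_nhds he0))).and
    ((h.tendsto_not_explored hεsum).eventually (Iic_mem_nhds hη))).exists
  replace hεe : ∀ s, s₀ ≤ s → (ε s : ℝ) ≤ e := hεe
  replace hex : P.real {ω | ∀ b, ∃ i < s₀, act i ω = b}ᶜ ≤ η := hex
  have hinit : ∀ᶠ t in atTop, ∫ ω, barrier (posSum (totals (hist act rew s₀ ω))
      / scale k (t + n - s₀)) ∂P ≤ η := by
    have h1 : Tendsto (fun t => t + n - s₀) atTop atTop :=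
      tendsto_atTop_mono (fun t => by omega : ∀ t, t - s₀ ≤ t + n - s₀)
        (tendsto_sub_atTop_nat s₀)
    exact (((h.tendsto_integral_barrier hk s₀).comp h1).eventually (Iic_mem_nhds hη))
  filter_upwards [hinit, eventually_ge_atTop (s₀ + T)] with t hinit ht
  set E : Set Ω := {ω | ∀ b, ∃ i < s₀, act i ω = b} with hE
  have hmt : ∀ s, Measurable fun ω => totals (hist act rew s ω) := fun s =>
    (measurable_totals s).comp (h.measurable_hist s)
  have hEm : MeasurableSet E := by
    have := h.measurable_hist s₀ (measurableSet_explored s₀ s₀)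
    rwa [show hist act rew s₀ ⁻¹' {x | Explored s₀ x} = E from
      Set.ext fun ω => explored_hist_iff act rew le_rfl ω] at this
  have hintb : ∀ s τ, Integrable (fun ω => barrier (shiftSum (scale k n)
      (totals (hist act rew s ω)) / scale k τ)) P := fun s τ =>
    Integrable.of_bound (measurable_barrier.comp (((measurable_shiftSum _).comp
      (hmt s)).div_const _)).aestronglyMeasurable 1 (Eventually.of_forall fun ω =>
        abs_barrier_shiftSum_le (scale_nonneg _ _) (scale_nonneg _ _) _)
  have hintp : ∀ s τ, Integrable (fun ω => potential (scale k τ) (c * scale k τ) c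
      (totals (hist act rew s ω))) P := fun s τ =>
    Integrable.of_bound ((measurable_potential _ _ _).comp (hmt s)).aestronglyMeasurable
      (1 + 20 * c * Fintype.card A) (Eventually.of_forall fun ω =>
        abs_potential_le (scale_nonneg _ _) hc.le _)
  -- With deadline `t + n`, exactly `T` rounds remain at `s₁` and `n` at `t`, where the scale equals
  -- the shift.
  obtain ⟨s₁, hs₁⟩ : ∃ s₁, s₁ + T = t + n := ⟨t + n - T, by omega⟩
  have hs01 : s₀ ≤ s₁ := by omega
  have hDs₁ : t + n - s₁ = T := by omega
  have hDt : t + n - t = n := by omega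
  -- the potential, from the end of the initial exploration to round `s₁`
  have hV := h.integral_potential_le hdet hcont hmom he hεe hk hm hM hc hc1 hec
    (hn1.trans hnT) (T := T) (hn3.trans (by gcongr)) (D := t + n) (s₁ - s₀) (by omega)
  rw [Nat.add_sub_cancel' hs01, hDs₁] at hV
  have hV0 : ∫ ω, E.indicator (fun ω => potential (scale k (t + n - s₀))
      (c * scale k (t + n - s₀)) c (totals (hist act rew s₀ ω))) ω ∂P ≤ 2 * η := by
    have hb : Integrable (fun ω => barrier (posSum (totals (hist act rew s₀ ω))
        / scale k (t + n - s₀))) P :=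
      Integrable.of_bound (measurable_barrier.comp ((measurable_posSum.comp
        (hmt s₀)).div_const _)).aestronglyMeasurable 1 (Eventually.of_forall fun ω => by
        rw [Real.norm_of_nonneg (barrier_nonneg
          (div_nonneg (posSum_nonneg _) (scale_nonneg _ _)))]
        exact barrier_le_one _)
    have := integral_mono ((hintp s₀ (t + n - s₀)).indicator hEm) (hb.add (integrable_const η))
      (fun ω => by
        refine (Set.indicator_le_self' (fun _ _ => potential_nonneg (scale_nonneg _ _) hc.le _)
          ω).trans ?_
        exact (potential_le hc.le _).trans (add_le_add_right hcK _))
    rw [integral_add' hb (integrable_const η)] at this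
    simp only [integral_const, probReal_univ, one_smul] at this
    linarith
  -- the barrier of the shifted sum, from round `s₁` to round `t`
  have hW := h.integral_barrier_shiftSum_le hdet hcont hmom he he0.le hεe hk hM hn1 hn2
    (D := t + n) hs01 (t - s₁) (by omega)
  rw [Nat.add_sub_cancel' (by omega : s₁ ≤ t), hDs₁, hDt] at hW
  have hscale : scale k T = √N * scale k n := by
    rw [scale, scale, ← Real.sqrt_mul hN0.le, hTc]
    congr 1; ring
  have hB := scale_pos hk hn1
  have hW1 : ∫ ω, E.indicator (fun ω => barrier (shiftSum (scale k n)
      (totals (hist act rew s₁ ω)) / scale k T)) ω ∂P ≤ 3 * η := by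
    have := integral_mono ((hintb s₁ T).indicator hEm)
      (((hintp s₁ T).indicator hEm).add (integrable_const η)) (fun ω => by
        simp only [Pi.add_apply]
        by_cases hω : ω ∈ E
        · rw [Set.indicator_of_mem hω, Set.indicator_of_mem hω]
          set x := totals (hist act rew s₁ ω)
          have h1 : barrier (shiftSum (scale k n) x / scale k T)
              ≤ barrier (posSum x / scale k T + K * scale k n / scale k T) := by
            rw [← add_div]
            exact barrier_mono (div_le_div_of_nonneg_right
              (shiftSum_le hB.le x) (scale_nonneg _ _))
          have h2 := barrier_add_le_lipschitz (q := posSum x / scale k T)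
            (x := K * scale k n / scale k T) (div_nonneg (posSum_nonneg x) (scale_nonneg _ _))
            (div_nonneg (by positivity) (scale_nonneg _ _))
          have h3 : 2 * (K * scale k n / scale k T) = 2 * K / √N := by
            rw [hscale]
            have := Real.sqrt_pos.2 hN0
            field_simp
          have h4 : barrier (posSum x / scale k T) ≤ potential (scale k T) (c * scale k T) c x :=
            le_add_of_nonneg_right (mul_nonneg (by positivity)
              (Finset.sum_nonneg fun _ _ => penalty_nonneg _))
          linarith
        · rw [Set.indicator_of_notMem hω, Set.indicator_of_notMem hω]
          linarith)
    rw [integral_add' ((hintp s₁ T).indicator hEm) (integrable_const η)] at this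
    simp only [integral_const, probReal_univ, one_smul] at this
    linarith
  have herr : ((t - s₁ : ℕ) : ℝ) * (K * e + 2 * M / scale k n ^ 4) ≤ 2 * η := by
    have h1 : ((t - s₁ : ℕ) : ℝ) ≤ T := by exact_mod_cast (by omega : t - s₁ ≤ T)
    have h2 : T * (2 * M / scale k n ^ 4) ≤ η := by
      rw [show scale k n ^ 4 = (scale k n ^ 2) ^ 2 by ring, scale_sq hk.le, hTc,
        mul_div_assoc', div_le_iff₀ (by positivity)]
      nlinarith [mul_le_mul_of_nonneg_right hn4 hn0.le]
    have h3 : 0 ≤ K * e + 2 * M / scale k n ^ 4 := by positivity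
    nlinarith [mul_le_mul_of_nonneg_right h1 h3]
  -- conclusion
  set G : Set Ω := {ω | ∀ b, totals (hist act rew t ω) b ≤ 0} with hG
  have hGm : MeasurableSet G := by
    simp only [hG, Set.ofPred_forall]
    exact MeasurableSet.iInter fun b => measurableSet_le
      ((measurable_pi_apply b).comp (hmt t)) measurable_const
  have hbad : P.real (E \ G) ≤ 5 * η := by
    refine le_trans ?_ (hW.trans (by linarith : _ ≤ 5 * η))
    have := integral_mono ((integrable_const (1 : ℝ)).indicator (hEm.diff hGm))
      ((hintb t n).indicator hEm) (fun ω => by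
        by_cases hω : ω ∈ E \ G
        · rw [Set.indicator_of_mem hω, Set.indicator_of_mem hω.1]
          have h1 := hω.2
          simp only [hG, Set.mem_ofPred_eq, not_forall, not_le] at h1
          obtain ⟨b, hb⟩ := h1
          have := le_shiftSum hB.le hb
          rw [barrier_of_one_le ((one_le_div hB).2 (by linarith))]
        · rw [Set.indicator_of_notMem hω]
          exact Set.indicator_nonneg (fun ω _ => barrier_nonneg
            (div_nonneg (shiftSum_nonneg hB.le _) hB.le)) ω)
    rwa [integral_indicator_const _ (hEm.diff hGm), smul_eq_mul, mul_one] at this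
  have hgood : 1 - 6 * η ≤ P.real (E ∩ G) := by
    have h1 := measureReal_inter_add_sdiff (μ := P) (s := E) (t := G) hGm
    have h2 := probReal_compl_eq_one_sub (μ := P) hEm
    linarith
  have hfin := h.mul_measureReal_le hdet hcont (s₀ := s₀) (t := t) (by omega)
  have hp1 : P.real (E ∩ G) ≤ 1 := measureReal_le_one
  have hp0 : 0 ≤ P.real (E ∩ G) := measureReal_nonneg
  have hεt := hεe t (by omega)
  have hεt0 := (ε t).2.1
  nlinarith

end

/-! ### Consequences of dominance -/

section

variable {A : Type*}

theorem IsDominant.integral_nonpos {F : A → Measure ℝ} [∀ a, IsProbabilityMeasure (F a)]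
    {a₀ : A} (hsub : ∀ a, IsSubGaussian (F a)) (hdom : IsDominant F a₀)
    (hdet : F a₀ = Measure.dirac 0) {a : A} (ha : a ≠ a₀) : ∫ x, x ∂(F a) ≤ 0 := by
  have h0 : ∫ x, x ∂(F a₀) = 0 := by rw [hdet, integral_dirac]
  rcases hdom a ha with h | h
  · exact h0 ▸ h.le
  · have := h.1 (fun x => x) (concaveOn_id convex_univ) monotone_id (hsub a).integrable_id
      (hsub a₀).integrable_id
    exact h0 ▸ this

/-- The identity is an admissible utility, so dominance orders the means weakly; a strict mean
inequality or a strict utility one way contradicts dominance the other way. -/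
theorem IsDominant.unique {F : A → Measure ℝ} [∀ a, IsProbabilityMeasure (F a)]
    (hsub : ∀ a, IsSubGaussian (F a)) {a b : A} (ha : IsDominant F a) (hb : IsDominant F b) :
    a = b := by
  have hmean : ∀ {c d : A}, SOSD (F c) (F d) → ∫ x, x ∂(F c) ≤ ∫ x, x ∂(F d) := fun h =>
    h.1 (fun x => x) (concaveOn_id convex_univ) monotone_id (hsub _).integrable_id
      (hsub _).integrable_id
  by_contra hne
  rcases ha b (Ne.symm hne) with h1 | h1 <;> rcases hb a hne with h2 | h2
  · exact lt_asymm h1 h2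
  · exact (hmean h2).not_gt h1
  · exact (hmean h1).not_gt h2
  · obtain ⟨u, hu, hmono, hi1, hi2, hlt⟩ := h1.2
    exact (h2.1 u hu hmono hi2 hi1).not_gt hlt

end

end Bandit

theorem theorem1 {A : Type u} [Fintype A] [Nonempty A] [MeasurableSpace A]
    [MeasurableSingletonClass A]
    (F : A → Measure ℝ) [∀ a, IsProbabilityMeasure (F a)]
    (hsub : ∀ a, Bandit.IsSubGaussian (F a))
    (ε : ℕ → unitInterval)
    (hε : Tendsto (fun t => (ε t : ℝ)) atTop (𝓝 0))
    (hεsum : Tendsto (fun n => ∑ t ∈ Finset.range n, (ε t : ℝ)) atTop atTop)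
    (a₀ : A) (hdom : Bandit.IsDominant F a₀) (hdet : F a₀ = Measure.dirac 0)
    (hsym : ∀ a, a ≠ a₀ → Bandit.IsSymmetric (F a) ∧ Bandit.IsContinuousDist (F a)) :
    Bandit.PerfectlyRiskAverseOn.{u, v} (Bandit.epsGreedy ε) F := by
  intro a ha Ω _ P _ act rew h
  obtain rfl := hdom.unique hsub ha
  obtain ⟨k, m, M, hk, hm, hM, hmom⟩ := Bandit.exists_momentBounds hsub
    (fun b hb => hdom.integral_nonpos hsub hdet hb) (fun b hb => (hsym b hb).2)
  refine Metric.tendsto_nhds.2 fun r hr => ?_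
  -- The total loss is then `7 * r / 8`, strictly below `r`.
  have h1 := h.eventually_le_measureReal hε hεsum hdet (fun b hb => (hsym b hb).2) hmom hk hm hM
    (by positivity : 0 < r / 8)
  filter_upwards [h1] with t ht
  have hle : P.real {ω | act t ω = a₀} ≤ 1 := measureReal_le_one
  rw [Real.dist_eq, abs_lt]
  constructor <;> linarith
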